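/- Graphs are finite directed multigraphs (parallel edges allowed). An $s$-$t$ DAG is a directed acyclic graph with $s$ as its unique source (vertex without in-edges) and $t$ as its unique sink (vertex without out-edges). Fix a linearly ordered commutative ring $\mathbb{Y}$ of flow values (for example $\mathbb{Z}$, $\mathbb{Q}$ or $\mathbb{R}$; nonnegative $\mathbb{Z}$-flows are the $\mathbb{N}$-flows). A flow on an $s$-$t$ DAG $G=(V,E)$ is a function $X:E\to\mathbb{Y}$ such that at every vertex other than $s,t$ the sum of $X$ over the incoming edges equals the sum over the outgoing edges; $|X|$ is the sum of $X$ over the edges leaving $s$. Inequalities between flows are edge-wise. For a flow $X\ge 0$, $G|_X$ is the spanning subgraph of $G$ consisting of the edges $e$ with $X(e)\neq 0$, and $\mathrm{width}(G|_X)$ is the minimum number of $s$-$t$ paths in $G|_X$ needed to cover all edges of $G|_X$. The graph $G$ is width-stable if $\mathrm{width}(G|_X)\le\mathrm{width}(G|_Y)$ for all flows $0\le X\le Y$ on $G$. A funnel is an $s$-$t$ DAG in which every $s$-$t$ path has an edge that is contained in no other $s$-$t$ path. A central path of a funnel subgraph $F$ of $G$ (with the same $s$ and $t$) is a directed path in $G$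 from a vertex of in-degree greater than $1$ in $F$ to a vertex of out-degree greater than $1$ in $F$. Let $G$ be an $s$-$t$ DAG. The following are equivalent: (1) $G$ is width-stable; (2) for every flow $X\ge 0$ on $G$ with $X\neq 0$ there is an $s$-$t$ path in $G|_X$ carrying $|X|/\mathrm{width}(G|_X)$ flow, i.e. each of whose edges $e$ satisfies $\mathrm{width}(G|_X)\cdot X(e)\ge |X|$; (3) $G$ has no funnel subgraph with a central path. -/

import Mathlib

/-- A directed multigraph with vertex type `V` and edge type `E` (parallel edges are allowed;
a simple digraph is the special case in which `e ↦ (src e, tgt e)` is injective). -/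
structure MultiDigraph (V E : Type*) where
  src : E → V
  tgt : E → V

namespace MultiDigraph

variable {V E : Type*}

/-- `G.IsWalk u p v`: the list of edges `p` is a directed walk in `G` from `u` to `v`. In acyclic
graphs, the only ones considered below, directed walks and directed paths are the same thing. -/
def IsWalk (G : MultiDigraph V E) : V → List E → V → Prop
  | u, [], v => u = v
  | u, e :: p, v => G.src e = u ∧ G.IsWalk (G.tgt e) p v

/-- A subgraph: a set of vertices and a set of edges whose endpoints are in the vertex set. -/
structure Subgraph (G : MultiDigraph V E) where
  verts : Set V
  edges : Set E
  src_mem : ∀ e ∈ edges, G.src e ∈ verts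
  tgt_mem : ∀ e ∈ edges, G.tgt e ∈ verts

/-- `G` as a subgraph of itself. -/
def whole (G : MultiDigraph V E) : G.Subgraph where
  verts := Set.univ
  edges := Set.univ
  src_mem := fun _ _ => Set.mem_univ _
  tgt_mem := fun _ _ => Set.mem_univ _

namespace Subgraph

variable {G : MultiDigraph V E}

/-- `p` is a directed path from `u` to `v` that only uses edges of `H`. -/
def IsPath (H : G.Subgraph) (u : V) (p : List E) (v : V) : Prop :=
  G.IsWalk u p v ∧ ∀ e ∈ p, e ∈ H.edges

/-- `H` has no directed cycle. -/
def IsAcyclic (H : G.Subgraph) : Prop :=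
  ∀ (v : V) (p : List E), H.IsPath v p v → p = []

/-- `H` is an `s`-`t` DAG: it is acyclic, `s` is its unique source (vertex without in-edges) and
`t` is its unique sink (vertex without out-edges). -/
structure IsSTDag (H : G.Subgraph) (s t : V) : Prop where
  acyclic : H.IsAcyclic
  source_mem : s ∈ H.verts
  sink_mem : t ∈ H.verts
  source_iff : ∀ v ∈ H.verts, (∀ e ∈ H.edges, G.tgt e ≠ v) ↔ v = s
  sink_iff : ∀ v ∈ H.verts, (∀ e ∈ H.edges, G.src e ≠ v) ↔ v = t

/-- The width of `H`: the minimum number of `s`-`t` paths in `H` that cover all edges of `H`. -/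
noncomputable def width (H : G.Subgraph) (s t : V) : ℕ :=
  sInf {k : ℕ | ∃ P : Fin k → List E,
    (∀ i, H.IsPath s (P i) t) ∧ ∀ e ∈ H.edges, ∃ i, e ∈ P i}

/-- `H` is a funnel: an `s`-`t` DAG in which every `s`-`t` path has a private edge, that is, an
edge which is contained in no other `s`-`t` path. -/
def IsFunnel (H : G.Subgraph) (s t : V) : Prop :=
  H.IsSTDag s t ∧
    ∀ p : List E, H.IsPath s p t → ∃ e ∈ p, ∀ q : List E, H.IsPath s q t → e ∈ q → q = p

/-- The in-degree of `v` in `H` is greater than `1`. -/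
def IsMerging (H : G.Subgraph) (v : V) : Prop :=
  1 < {e ∈ H.edges | G.tgt e = v}.ncard

/-- The out-degree of `v` in `H` is greater than `1`. -/
def IsForking (H : G.Subgraph) (v : V) : Prop :=
  1 < {e ∈ H.edges | G.src e = v}.ncard

/-- `p` is a central path of `H`: a path in `G` (not necessarily in `H`) from a merging node of
`H` to a forking node of `H`. -/
def IsCentralPath (H : G.Subgraph) (p : List E) : Prop :=
  ∃ u v : V, H.IsMerging u ∧ H.IsForking v ∧ G.IsWalk u p v

end Subgraph

/-- Spanning subgraph of `G` made up of the edges `e` with `X e ≠ 0`. -/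
def restrict {R : Type*} [Zero R] (G : MultiDigraph V E) (X : E → R) : G.Subgraph where
  verts := Set.univ
  edges := {e | X e ≠ 0}
  src_mem := fun _ _ => Set.mem_univ _
  tgt_mem := fun _ _ => Set.mem_univ _

section Flow

variable {R : Type*} [Fintype E] [DecidableEq V]

/-- `X` satisfies conservation of flow at every vertex other than `s` and `t`. -/
def IsFlow [AddCommMonoid R] (G : MultiDigraph V E) (s t : V) (X : E → R) : Prop :=
  ∀ v : V, v ≠ s → v ≠ t → ∑ e with G.tgt e = v, X e = ∑ e with G.src e = v, X e

/-- The value `|X|`: the total flow out of `s`. -/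
def flowValue [AddCommMonoid R] (G : MultiDigraph V E) (s : V) (X : E → R) : R :=
  ∑ e with G.src e = s, X e

/-- `G` is width-stable, with respect to flows with values in `R`. -/
def WidthStable (R : Type*) [AddCommMonoid R] [LE R] (G : MultiDigraph V E) (s t : V) : Prop :=
  ∀ X Y : E → R, G.IsFlow s t X → G.IsFlow s t Y → 0 ≤ X → X ≤ Y →
    (G.restrict X).width s t ≤ (G.restrict Y).width s t

/-- `G` has paths of large weight, with respect to flows with values in `R`: for every nonzero
flow `X ≥ 0`, some `s`-`t` path in `G|_X` carries `|X| / width(G|_X)` flow, that is,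
`X e ≥ |X| / width(G|_X)` for all its edges `e`. Since the width is a positive integer here, the
inequality is written without division, so that it makes sense for integer flows as well. -/
def HasPathsOfLargeWeight (R : Type*) [Semiring R] [LE R]
    (G : MultiDigraph V E) (s t : V) : Prop :=
  ∀ X : E → R, G.IsFlow s t X → 0 ≤ X → X ≠ 0 →
    ∃ p : List E, (G.restrict X).IsPath s p t ∧
      ∀ e ∈ p, G.flowValue s X ≤ ((G.restrict X).width s t : R) * X e

end Flow

end MultiDigraph

/-! Lower bounds on the width come from closed sets: if no edge of `H` leaves `D`, an `s`-`t` path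
of `H` enters `D` at most once, so the edges entering `D` need distinct paths in any cover
(`IsCovered.card_le_width`).

(1) ⇒ (2): if no path carries `|X| / width`, then `s` is cut from `t` by edges that are all lighter
than this, so there are more than `width` of them. Suitable paths through these edges form a
subgraph of `G|_X` in which they enter a closed set; its width exceeds that of `G|_X`, against
stability.

(2) ⇒ (3): let a funnel with `k` paths have a central path. Send `k` units along each funnel path
and one unit along a path `q` through the central path. Then `q` makes two funnel paths superfluous,
so the width is at most `k - 1`, yet every path in the support has an edge of flow at most `k + 1`,
and `(k - 1)(k + 1) < k² + 1`.

(3) ⇒ (1): Dilworth's theorem gives at least `width(G|_X)` pairwise unreachable edges, and a funnel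
in `G|_X` runs through them. Without a central path, the vertices reachable in `G` from merging
vertices of the funnel, together with `t`, form a set closed in all of `G`, which every funnel path
enters by an edge of its own. These edges survive in `G|_Y` and bound its width from below. -/

/-! ### Chains and antichains. -/

/-- **Dilworth's theorem** for a finite set and a transitive relation with a rank function: there
is an antichain `C` such that the set is a union of at most `#C` chains. -/
theorem exists_antichain_chain_coloring {α : Type*} (lt : α → α → Prop) (r : α → ℕ)
    (htr : ∀ x y z, lt x y → lt y z → lt x z) (hr : ∀ x y, lt x y → r x < r y) (S : Finset α) :
    ∃ C ⊆ S, (∀ x ∈ C, ∀ y ∈ C, ¬ lt x y) ∧ ∃ f : α → ℕ, (∀ x ∈ S, f x < C.card) ∧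
      ∀ x ∈ S, ∀ y ∈ S, f x = f y → x ≠ y → lt x y ∨ lt y x := by
  classical
  induction S using Finset.strongInduction with
  | H S ih =>
  rcases S.eq_empty_or_nonempty with rfl | hne
  · exact ⟨∅, by simp, by simp, fun _ => 0, by simp, by simp⟩
  obtain ⟨a, haS, hamax⟩ := Finset.exists_max_image S r hne
  obtain ⟨C₀, hC₀S, hC₀, f, hfC, hf⟩ := ih (S.erase a) (Finset.erase_ssubset haS)
  set k := C₀.card with hk
  -- Colour classes are chains, so `f` is injective on an antichain; one with `k` elements meets all
  -- `k` classes.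
  have hit : ∀ A ⊆ S.erase a, (∀ x ∈ A, ∀ y ∈ A, ¬ lt x y) → A.card = k →
      ∀ c < k, ∃ x ∈ A, f x = c := by
    intro A hA hanti hcard c hc
    have hinj : Set.InjOn f A := by
      intro x hx y hy hxy
      by_contra hne
      rcases hf x (hA hx) y (hA hy) hxy hne with h | h
      · exact hanti _ hx _ hy h
      · exact hanti _ hy _ hx h
    have himg : A.image f = Finset.range k := by
      apply Finset.eq_of_subset_of_card_le
      · intro y hy
        obtain ⟨x, hx, rfl⟩ := Finset.mem_image.1 hy
        exact Finset.mem_range.2 (hfC x (hA hx))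
      · rw [Finset.card_image_of_injOn hinj, hcard, Finset.card_range]
    have : c ∈ A.image f := by rw [himg]; exact Finset.mem_range.2 hc
    simpa using this
  let good : α → Prop := fun x => ∃ A ⊆ S.erase a, (∀ x ∈ A, ∀ y ∈ A, ¬ lt x y) ∧
    A.card = k ∧ x ∈ A
  -- `x c` is the highest element of class `c` lying on some antichain of size `k`. These tops form
  -- an antichain themselves.
  have hx : ∀ c < k, ∃ x, x ∈ S.erase a ∧ f x = c ∧ good x ∧
      ∀ y ∈ S.erase a, f y = c → good y → y ≠ x → lt y x := by
    intro c hc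
    have hne : ((S.erase a).filter fun x => f x = c ∧ good x).Nonempty := by
      obtain ⟨x, hxC, hxc⟩ := hit C₀ hC₀S hC₀ rfl c hc
      exact ⟨x, by simpa using ⟨by simpa using hC₀S hxC, hxc, C₀, hC₀S, hC₀, rfl, hxC⟩⟩
    obtain ⟨x, hxm, hxmax⟩ := Finset.exists_max_image _ r hne
    obtain ⟨hxS, hxc, hxg⟩ := Finset.mem_filter.1 hxm
    refine ⟨x, hxS, hxc, hxg, fun y hy hyc hyg hyx => ?_⟩
    rcases hf y hy x hxS (hyc.trans hxc.symm) hyx with h | h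
    · exact h
    · exact absurd (hxmax y (Finset.mem_filter.2 ⟨hy, hyc, hyg⟩)) (not_le.2 (hr _ _ h))
  have : Nonempty α := ⟨a⟩
  choose! x hxS hxc hxg hxmax using hx
  have hxanti : ∀ c < k, ∀ d < k, ¬ lt (x c) (x d) := by
    intro c hc d hd hlt
    obtain ⟨A, hAS, hA, hAk, hdA⟩ := hxg d hd
    obtain ⟨y, hyA, hyc⟩ := hit A hAS hA hAk c hc
    by_cases hy : y = x c
    · exact hA _ hyA _ hdA (hy ▸ hlt)
    · exact hA _ hyA _ hdA
        (htr _ _ _ (hxmax c hc y (hAS hyA) hyc ⟨A, hAS, hA, hAk, hyA⟩ hy) hlt)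
  set A := (Finset.range k).image x with hA
  have hAcard : A.card = k := by
    rw [hA, Finset.card_image_of_injOn, Finset.card_range]
    intro c hc d hd hcd
    rw [← hxc c (by simpa using hc), ← hxc d (by simpa using hd)]
    exact congrArg f hcd
  have hAS : A ⊆ S.erase a := by
    intro y hy
    obtain ⟨c, hc, rfl⟩ := Finset.mem_image.1 hy
    exact hxS c (Finset.mem_range.1 hc)
  have hAanti : ∀ x ∈ A, ∀ y ∈ A, ¬ lt x y := by
    intro y hy z hz
    obtain ⟨c, hc, rfl⟩ := Finset.mem_image.1 hy
    obtain ⟨d, hd, rfl⟩ := Finset.mem_image.1 hz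
    exact hxanti c (Finset.mem_range.1 hc) d (Finset.mem_range.1 hd)
  have haA : a ∉ A := fun h => Finset.notMem_erase a S (hAS h)
  have hamax' : ∀ y ∈ S, ¬ lt a y := fun y hy h => absurd (hamax y hy) (not_le.2 (hr _ _ h))
  by_cases hcase : ∃ c < k, lt (x c) a
  · obtain ⟨c, hc, hca⟩ := hcase
    -- `K` is a chain: `a` with the part of class `c` up to `x c`. An antichain of size `k` avoiding
    -- `a` meets class `c` at or below `x c`, hence meets `K`. So the rest needs fewer than `k`
    -- colours, and `K` gets the fresh colour `C₁.card`.
    let K : α → Prop := fun z => z = a ∨ (f z = c ∧ (z = x c ∨ lt z (x c)))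
    have hlta : ∀ z, f z = c → (z = x c ∨ lt z (x c)) → lt z a := by
      rintro z - (rfl | h)
      · exact hca
      · exact htr _ _ _ h hca
    obtain ⟨C₁, hC₁S, hC₁, f₁, hf₁C, hf₁⟩ := ih (S.filter fun z => ¬ K z)
      (Finset.filter_ssubset.2 ⟨a, haS, not_not.2 (Or.inl rfl)⟩)
    have hsub : ∀ B ⊆ S.filter (fun z => ¬ K z), B ⊆ S.erase a := fun B hB y hy => by
      have := Finset.mem_filter.1 (hB hy)
      exact Finset.mem_erase.2 ⟨fun h => this.2 (Or.inl h), this.1⟩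
    have hlt : C₁.card < k := by
      by_contra hge
      obtain ⟨B, hBC, hBk⟩ := Finset.exists_subset_card_eq (not_lt.1 hge)
      have hBS := hsub B (hBC.trans hC₁S)
      have hBanti : ∀ x ∈ B, ∀ y ∈ B, ¬ lt x y := fun x hx y hy => hC₁ x (hBC hx) y (hBC hy)
      obtain ⟨z, hzB, hzc⟩ := hit B hBS hBanti hBk c hc
      refine (Finset.mem_filter.1 (hC₁S (hBC hzB))).2 (Or.inr ⟨hzc, ?_⟩)
      by_cases hz : z = x c
      · exact Or.inl hz
      · exact Or.inr (hxmax c hc z (hBS hzB) hzc ⟨B, hBS, hBanti, hBk, hzB⟩ hz)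
    refine ⟨A, hAS.trans (Finset.erase_subset _ _), hAanti,
      fun z => if K z then C₁.card else f₁ z, fun z hz => ?_, fun y hy z hz hyz hne => ?_⟩
    · rw [hAcard]
      dsimp only
      split_ifs with h
      · exact hlt
      · exact (hf₁C z (Finset.mem_filter.2 ⟨hz, h⟩)).trans hlt
    · dsimp only at hyz
      split_ifs at hyz with h₁ h₂ h₂
      · rcases h₁ with rfl | h₁ <;> rcases h₂ with rfl | h₂
        · exact absurd rfl hne
        · exact Or.inr (hlta z h₂.1 h₂.2)
        · exact Or.inl (hlta y h₁.1 h₁.2)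
        · by_cases hya : y = a
          · exact absurd (hya ▸ hlta y h₁.1 h₁.2) (hamax' a haS)
          by_cases hza : z = a
          · exact absurd (hza ▸ hlta z h₂.1 h₂.2) (hamax' a haS)
          exact hf y (Finset.mem_erase.2 ⟨hya, hy⟩) z (Finset.mem_erase.2 ⟨hza, hz⟩)
            (h₁.1.trans h₂.1.symm) hne
      · exact absurd hyz (hf₁C z (Finset.mem_filter.2 ⟨hz, h₂⟩)).ne'
      · exact absurd hyz (hf₁C y (Finset.mem_filter.2 ⟨hy, h₁⟩)).ne
      · exact hf₁ y (Finset.mem_filter.2 ⟨hy, h₁⟩) z (Finset.mem_filter.2 ⟨hz, h₂⟩) hyz hne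
  -- Now `a` is incomparable to every top, so it enlarges the antichain and takes a new colour.
  · push Not at hcase
    have hAa : ∀ y ∈ A, ¬ lt y a := by
      intro y hy
      obtain ⟨c, hc, rfl⟩ := Finset.mem_image.1 hy
      exact hcase c (Finset.mem_range.1 hc)
    have hAaS : insert a A ⊆ S := Finset.insert_subset haS (hAS.trans (Finset.erase_subset _ _))
    refine ⟨insert a A, hAaS, ?_, fun z => if z = a then k else f z, fun z hz => ?_,
      fun y hy z hz hyz hne => ?_⟩
    · intro y hy z hz
      rcases Finset.mem_insert.1 hy with h | hyA
      · exact h ▸ hamax' z (hAaS hz)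
      · rcases Finset.mem_insert.1 hz with h | hzA
        · exact h ▸ hAa y hyA
        · exact hAanti y hyA z hzA
    · rw [Finset.card_insert_of_notMem haA, hAcard]
      dsimp only
      split_ifs with h
      · exact Nat.lt_succ_self k
      · exact (hfC z (Finset.mem_erase.2 ⟨h, hz⟩)).trans (Nat.lt_succ_self k)
    · dsimp only at hyz
      split_ifs at hyz with h₁ h₂ h₂
      · exact absurd (h₁.trans h₂.symm) hne
      · exact absurd hyz (hfC z (Finset.mem_erase.2 ⟨h₂, hz⟩)).ne'
      · exact absurd hyz (hfC y (Finset.mem_erase.2 ⟨h₁, hy⟩)).ne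
      · exact hf y (Finset.mem_erase.2 ⟨h₁, hy⟩) z (Finset.mem_erase.2 ⟨h₂, hz⟩) hyz hne

/-! ### Walks, ranks, covers by paths and closed sets. -/

namespace MultiDigraph

variable {V E : Type*} {G : MultiDigraph V E} {s t : V}

theorem isWalk_append {p q : List E} {u w : V} :
    G.IsWalk u (p ++ q) w ↔ ∃ v, G.IsWalk u p v ∧ G.IsWalk v q w := by
  induction p generalizing u with
  | nil => simp [IsWalk]
  | cons e p ih => simp [IsWalk, ih, and_assoc]

theorem isWalk_singleton (e : E) : G.IsWalk (G.src e) [e] (G.tgt e) := ⟨rfl, rfl⟩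

theorem IsWalk.eq_target {p : List E} {u v w : V} (h : G.IsWalk u p v) (h' : G.IsWalk u p w) :
    v = w := by
  induction p generalizing u with
  | nil => exact h.symm.trans h'
  | cons e p ih => exact ih h.2 h'.2

/-- A rank function increases strictly along every edge. -/
def IsRank (G : MultiDigraph V E) (r : V → ℕ) : Prop := ∀ e, r (G.src e) < r (G.tgt e)

/-- The rank of `v` counts the edges from whose head `v` is reachable. Passing along `e` keeps all
of them and adds `e` itself, which acyclicity excludes at its tail. -/
theorem exists_isRank [Fintype E] (hac : ∀ v p, G.IsWalk v p v → p = []) :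
    ∃ r, G.IsRank r := by
  classical
  refine ⟨fun v => (Finset.univ.filter fun e => ∃ p, G.IsWalk (G.tgt e) p v).card, fun e => ?_⟩
  apply Finset.card_lt_card
  rw [Finset.ssubset_iff_of_subset]
  · refine ⟨e, by simpa using ⟨[], rfl⟩, ?_⟩
    simp only [Finset.mem_filter, Finset.mem_univ, true_and, not_exists]
    intro p hp
    simpa using hac (G.src e) (e :: p) ⟨rfl, hp⟩
  · intro f
    simp only [Finset.mem_filter, Finset.mem_univ, true_and]
    rintro ⟨p, hp⟩
    exact ⟨p ++ [e], isWalk_append.2 ⟨_, hp, isWalk_singleton e⟩⟩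

section Rank

variable {r : V → ℕ}

theorem IsRank.le_of_isWalk (hr : G.IsRank r) {p : List E} {u v : V} (h : G.IsWalk u p v) :
    r u + p.length ≤ r v := by
  induction p generalizing u with
  | nil => rw [show u = v from h]; simp
  | cons e p ih =>
    have h₁ := ih h.2
    have h₂ := hr e
    rw [h.1] at h₂
    simp only [List.length_cons]
    omega

theorem IsRank.eq_nil (hr : G.IsRank r) {p : List E} {u : V} (h : G.IsWalk u p u) : p = [] :=
  List.length_eq_zero_iff.1 (by have := hr.le_of_isWalk h; omega)

theorem IsRank.no_cycle (hr : G.IsRank r) {p q : List E} {e : E} {u v : V}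
    (hp : G.IsWalk u p v) (hq : G.IsWalk v q u) (he : e ∈ p) : False := by
  have := hr.eq_nil (isWalk_append.2 ⟨_, hp, hq⟩)
  simp_all

theorem IsRank.nodup (hr : G.IsRank r) {p : List E} {u v : V} (h : G.IsWalk u p v) :
    p.Nodup := by
  induction p generalizing u with
  | nil => exact List.nodup_nil
  | cons e p ih =>
    refine List.nodup_cons.2 ⟨fun he => ?_, ih h.2⟩
    obtain ⟨a, b, rfl⟩ := List.append_of_mem he
    obtain ⟨v, h₁, h₂⟩ := isWalk_append.1 h.2
    rw [← h₂.1] at h₁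
    exact hr.no_cycle (isWalk_singleton e) h₁ List.mem_cons_self

end Rank

/-- `s` has no in-edges and `t` has no out-edges. -/
structure IsTerminalPair (G : MultiDigraph V E) (s t : V) : Prop where
  tgt_ne : ∀ e, G.tgt e ≠ s
  src_ne : ∀ e, G.src e ≠ t

theorem IsTerminalPair.eq_of_isWalk (h : G.IsTerminalPair s t) {p : List E} {v : V}
    (hp : G.IsWalk v p s) : v = s := by
  rcases List.eq_nil_or_concat p with rfl | ⟨q, e, rfl⟩
  · exact hp
  · rw [List.concat_eq_append] at hp
    obtain ⟨w, -, h₂⟩ := isWalk_append.1 hp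
    exact absurd h₂.2 (h.tgt_ne e)

theorem IsTerminalPair.eq_nil_of_isWalk (h : G.IsTerminalPair s t) {p : List E} {v : V}
    (hp : G.IsWalk t p v) : p = [] := by
  cases p with
  | nil => rfl
  | cons e p => exact absurd hp.1 (h.src_ne e)

theorem IsTerminalPair.of_isSTDag (h : G.whole.IsSTDag s t) : G.IsTerminalPair s t :=
  ⟨fun e => (h.source_iff s h.source_mem).2 rfl e trivial,
    fun e => (h.sink_iff t h.sink_mem).2 rfl e trivial⟩

namespace Subgraph

variable {H : G.Subgraph}

theorem isPath_append {p q : List E} {u w : V} :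
    H.IsPath u (p ++ q) w ↔ ∃ v, H.IsPath u p v ∧ H.IsPath v q w := by
  simp only [IsPath, isWalk_append, List.mem_append, or_imp, forall_and]
  constructor
  · rintro ⟨⟨v, h₁, h₂⟩, h₃, h₄⟩
    exact ⟨v, ⟨h₁, h₃⟩, h₂, h₄⟩
  · rintro ⟨v, ⟨h₁, h₃⟩, h₂, h₄⟩
    exact ⟨⟨v, h₁, h₂⟩, h₃, h₄⟩

theorem isPath_cons {e : E} {p : List E} {u w : V} :
    H.IsPath u (e :: p) w ↔ G.src e = u ∧ e ∈ H.edges ∧ H.IsPath (G.tgt e) p w := by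
  simp only [IsPath, IsWalk, List.forall_mem_cons]
  tauto

theorem isPath_nil {u : V} : H.IsPath u [] u := ⟨rfl, by simp⟩

/-- Every edge of `H` lies on an `s`-`t` path of `H`. -/
def IsCovered (H : G.Subgraph) (s t : V) : Prop :=
  ∀ e ∈ H.edges, ∃ p, H.IsPath s p t ∧ e ∈ p

theorem IsCovered.exists_paths (h : H.IsCovered s t) {e : E} (he : e ∈ H.edges) :
    ∃ p q, H.IsPath s p (G.src e) ∧ H.IsPath (G.tgt e) q t := by
  obtain ⟨p, hp, hep⟩ := h e he
  obtain ⟨a, b, rfl⟩ := List.append_of_mem hep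
  obtain ⟨v, h₁, h₂⟩ := isPath_append.1 hp
  obtain ⟨rfl, -, h₃⟩ := isPath_cons.1 h₂
  exact ⟨a, b, h₁, h₃⟩

/-- Extend an edge backwards and forwards one edge at a time. Ranks fall or rise strictly and are
bounded, so the process stops, and it can only stop at `s` and `t`. -/
theorem isCovered_of_local {r : V → ℕ} (hr : G.IsRank r) [Finite E]
    (h₁ : ∀ e ∈ H.edges, G.src e ≠ s → ∃ f ∈ H.edges, G.tgt f = G.src e)
    (h₂ : ∀ e ∈ H.edges, G.tgt e ≠ t → ∃ f ∈ H.edges, G.src f = G.tgt e) : H.IsCovered s t := by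
  have back : ∀ n, ∀ e ∈ H.edges, r (G.src e) = n → ∃ p, H.IsPath s p (G.src e) := by
    intro n
    induction n using Nat.strong_induction_on with
    | _ n ih =>
    intro e he hn
    by_cases hes : G.src e = s
    · exact ⟨[], hes ▸ isPath_nil⟩
    · obtain ⟨f, hf, hfe⟩ := h₁ e he hes
      obtain ⟨p, hp⟩ := ih (r (G.src f)) (by have := hr f; rw [hfe] at this; omega) f hf rfl
      exact ⟨p ++ [f], isPath_append.2 ⟨_, hp, isPath_cons.2 ⟨rfl, hf, hfe ▸ isPath_nil⟩⟩⟩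
  obtain ⟨N, hN⟩ : ∃ N, ∀ e, r (G.tgt e) ≤ N := by
    obtain ⟨N, hN⟩ := (Set.finite_range fun e => r (G.tgt e)).bddAbove
    exact ⟨N, fun e => hN ⟨e, rfl⟩⟩
  have forth : ∀ n, ∀ e ∈ H.edges, N - r (G.tgt e) = n → ∃ p, H.IsPath (G.tgt e) p t := by
    intro n
    induction n using Nat.strong_induction_on with
    | _ n ih =>
    intro e he hn
    by_cases het : G.tgt e = t
    · exact ⟨[], het ▸ isPath_nil⟩
    · obtain ⟨f, hf, hfe⟩ := h₂ e he het
      obtain ⟨p, hp⟩ := ih (N - r (G.tgt f))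
        (by have := hr f; have := hN f; rw [hfe] at *; omega) f hf rfl
      exact ⟨f :: p, isPath_cons.2 ⟨hfe, hf, hp⟩⟩
  intro e he
  obtain ⟨p, hp⟩ := back _ e he rfl
  obtain ⟨q, hq⟩ := forth _ e he rfl
  exact ⟨p ++ e :: q, isPath_append.2 ⟨_, hp, isPath_cons.2 ⟨rfl, he, hq⟩⟩, by simp⟩

theorem width_le {k : ℕ} (P : Fin k → List E) (hP : ∀ i, H.IsPath s (P i) t)
    (hcov : ∀ e ∈ H.edges, ∃ i, e ∈ P i) : H.width s t ≤ k :=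
  Nat.sInf_le ⟨P, hP, hcov⟩

theorem width_le_card (A : Finset (List E)) (hA : ∀ p ∈ A, H.IsPath s p t)
    (hcov : ∀ e ∈ H.edges, ∃ p ∈ A, e ∈ p) : H.width s t ≤ A.card :=
  width_le (fun i => (A.equivFin.symm i : List E)) (fun i => hA _ (A.equivFin.symm i).2)
    fun e he => by
      obtain ⟨p, hp, hep⟩ := hcov e he
      exact ⟨A.equivFin ⟨p, hp⟩, by simpa using hep⟩

theorem IsCovered.exists_width_cover [Finite E] (h : H.IsCovered s t) :
    ∃ P : Fin (H.width s t) → List E,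
      (∀ i, H.IsPath s (P i) t) ∧ ∀ e ∈ H.edges, ∃ i, e ∈ P i := by
  apply Nat.sInf_mem (s := {k : ℕ | ∃ P : Fin k → List E,
    (∀ i, H.IsPath s (P i) t) ∧ ∀ e ∈ H.edges, ∃ i, e ∈ P i})
  obtain ⟨n, ⟨φ⟩⟩ := Finite.exists_equiv_fin H.edges
  choose! p hp hep using h
  exact ⟨n, fun i => p (φ.symm i), fun i => hp _ (φ.symm i).2,
    fun e he => ⟨φ ⟨e, he⟩, by simpa using hep e he⟩⟩

/-- `D` is closed under the edges of `H`. -/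
def IsClosedSet (H : G.Subgraph) (D : Set V) : Prop :=
  ∀ e ∈ H.edges, G.src e ∈ D → G.tgt e ∈ D

theorem IsClosedSet.src_mem {D : Set V} (hD : H.IsClosedSet D) {p : List E} {u v : V}
    (hp : H.IsPath u p v) (hu : u ∈ D) : ∀ e ∈ p, G.src e ∈ D := by
  induction p generalizing u with
  | nil => simp
  | cons e p ih =>
    obtain ⟨rfl, he, hp⟩ := isPath_cons.1 hp
    exact List.forall_mem_cons.2 ⟨hu, ih hp (hD e he hu)⟩

theorem IsClosedSet.eq_of_crossing {D : Set V} (hD : H.IsClosedSet D) {p : List E} {u v : V}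
    (hp : H.IsPath u p v) {e f : E} (he : e ∈ p) (hf : f ∈ p)
    (he₁ : G.src e ∉ D) (he₂ : G.tgt e ∈ D) (hf₁ : G.src f ∉ D) (hf₂ : G.tgt f ∈ D) : e = f := by
  induction p generalizing u with
  | nil => simp at he
  | cons a p ih =>
    obtain ⟨rfl, -, hp⟩ := isPath_cons.1 hp
    rcases List.mem_cons.1 he with rfl | he' <;> rcases List.mem_cons.1 hf with rfl | hf'
    · rfl
    · exact absurd (hD.src_mem hp he₂ _ hf') hf₁
    · exact absurd (hD.src_mem hp hf₂ _ he') he₁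
    · exact ih hp he' hf'

theorem exists_crossing {D : Set V} {p : List E} {u v : V}
    (hp : H.IsPath u p v) (hu : u ∉ D) (hv : v ∈ D) :
    ∃ e ∈ p, G.src e ∉ D ∧ G.tgt e ∈ D := by
  induction p generalizing u with
  | nil => exact absurd ((show u = v from hp.1) ▸ hv) hu
  | cons a p ih =>
    obtain ⟨rfl, -, hp⟩ := isPath_cons.1 hp
    by_cases ha : G.tgt a ∈ D
    · exact ⟨a, by simp, hu, ha⟩
    · obtain ⟨e, he, h⟩ := ih hp ha
      exact ⟨e, List.mem_cons_of_mem _ he, h⟩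

/-- A path cannot leave `D` once inside, so it contains at most one edge of `K`; assigning to each
edge of `K` a covering path is injective. -/
theorem IsCovered.card_le_width [Finite E] (h : H.IsCovered s t) {D : Set V}
    (hD : H.IsClosedSet D) (K : Finset E)
    (hK : ∀ e ∈ K, e ∈ H.edges ∧ G.src e ∉ D ∧ G.tgt e ∈ D) : K.card ≤ H.width s t := by
  obtain ⟨P, hP, hcov⟩ := h.exists_width_cover
  have : ∀ e ∈ K, ∃ i, e ∈ P i := fun e he => hcov e (hK e he).1
  choose i hi using this
  have hinj : Function.Injective fun e : K => i e.1 e.2 := by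
    rintro ⟨e, he⟩ ⟨f, hf⟩ hef
    have h₁ := hi e he
    have h₂ := hi f hf
    dsimp only at hef
    rw [hef] at h₁
    exact Subtype.ext (hD.eq_of_crossing (hP _) h₁ h₂ (hK e he).2.1 (hK e he).2.2
      (hK f hf).2.1 (hK f hf).2.2)
  simpa using Fintype.card_le_of_injective _ hinj

/-- If in-edges are unique outside the closed set `D` and out-edges are unique inside `D`, then an
edge entering `D` lies on at most one `s`-`t` path. -/
theorem IsClosedSet.path_unique (hst : G.IsTerminalPair s t) {D : Set V} (hD : H.IsClosedSet D)
    (hin : ∀ e ∈ H.edges, ∀ f ∈ H.edges, G.tgt e = G.tgt f → G.tgt e ∉ D → e = f)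
    (hout : ∀ e ∈ H.edges, ∀ f ∈ H.edges, G.src e = G.src f → G.src e ∈ D → e = f)
    {p q : List E} (hp : H.IsPath s p t) (hq : H.IsPath s q t) {e : E} (hep : e ∈ p)
    (heq : e ∈ q) (he₁ : G.src e ∉ D) (he₂ : G.tgt e ∈ D) : q = p := by
  -- Beyond `e` the path stays in `D`, where each continuation is forced; before `e` it stays
  -- outside `D`, where it is forced backwards.
  have forth : ∀ (p q : List E) (u : V), u ∈ D → H.IsPath u p t → H.IsPath u q t → q = p := by
    intro p
    induction p with
    | nil =>
      intro q u _ hp hq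
      exact hst.eq_nil_of_isWalk ((show u = t from hp.1) ▸ hq.1)
    | cons a p ih =>
      intro q u hu hp hq
      cases q with
      | nil => exact (hst.eq_nil_of_isWalk ((show u = t from hq.1) ▸ hp.1)).symm
      | cons b q =>
        obtain ⟨ha, haH, hp⟩ := isPath_cons.1 hp
        obtain ⟨hb, hbH, hq⟩ := isPath_cons.1 hq
        obtain rfl := hout a haH b hbH (ha.trans hb.symm) (ha ▸ hu)
        rw [ih q _ (hD a haH (ha ▸ hu)) hp hq]
  have back : ∀ (p q : List E) (v : V), v ∉ D → H.IsPath s p v → H.IsPath s q v → q = p := by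
    intro p
    induction p using List.reverseRecOn with
    | nil =>
      intro q v _ hp hq
      have hv : s = v := hp.1
      subst hv
      rcases List.eq_nil_or_concat q with rfl | ⟨q, b, rfl⟩
      · rfl
      · rw [List.concat_eq_append] at hq
        obtain ⟨w, -, hb⟩ := isPath_append.1 hq
        exact absurd hb.1.2 (hst.tgt_ne b)
    | append_singleton p a ih =>
      intro q v hv hp hq
      obtain ⟨w, hp', ha⟩ := isPath_append.1 hp
      obtain ⟨rfl, haH, ha⟩ := isPath_cons.1 ha
      obtain rfl : G.tgt a = v := ha.1
      rcases List.eq_nil_or_concat q with rfl | ⟨q, b, rfl⟩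
      · exact absurd (Eq.symm hq.1) (hst.tgt_ne a)
      · rw [List.concat_eq_append] at hq ⊢
        obtain ⟨w, hq, hb⟩ := isPath_append.1 hq
        obtain ⟨rfl, hbH, hb⟩ := isPath_cons.1 hb
        have hb' : G.tgt b = G.tgt a := hb.1
        obtain rfl := hin a haH b hbH hb'.symm hv
        rw [ih q _ (fun h => hv (hD a haH h)) hp' hq]
  obtain ⟨p₁, p₂, rfl⟩ := List.append_of_mem hep
  obtain ⟨q₁, q₂, rfl⟩ := List.append_of_mem heq
  obtain ⟨v, hp₁, hp₂⟩ := isPath_append.1 hp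
  obtain ⟨rfl, -, hp₂⟩ := isPath_cons.1 hp₂
  obtain ⟨v, hq₁, hq₂⟩ := isPath_append.1 hq
  obtain ⟨rfl, -, hq₂⟩ := isPath_cons.1 hq₂
  rw [back p₁ q₁ _ he₁ hp₁ hq₁, forth p₂ q₂ _ he₂ hp₂ hq₂]

end Subgraph

end MultiDigraph

/-! ### Flows, and paths of large weight in width-stable graphs. -/

namespace MultiDigraph

variable {V E : Type*} {G : MultiDigraph V E} {s t : V} {R : Type*} [CommRing R]

open Classical in
/-- The flow carrying one unit along every occurrence of an edge in `p`. -/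
noncomputable def pathFlow (R : Type*) [CommRing R] (p : List E) : E → R :=
  fun e => (p.count e : R)

theorem pathFlow_eq_one {r : V → ℕ} (hr : G.IsRank r) {p : List E} {u v : V}
    (h : G.IsWalk u p v) {e : E} (he : e ∈ p) : pathFlow R p e = 1 := by
  classical
  simp only [pathFlow]
  rw [List.count_eq_one_of_mem (hr.nodup h) he, Nat.cast_one]

theorem pathFlow_eq_zero {p : List E} {e : E} (he : e ∉ p) : pathFlow R p e = 0 := by
  classical simp only [pathFlow, List.count_eq_zero_of_not_mem he, Nat.cast_zero]

theorem pathFlow_nonneg [LinearOrder R] [IsStrictOrderedRing R] (p : List E) (e : E) : 0 ≤ pathFlow R p e := Nat.cast_nonneg _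

variable [DecidableEq V] [Fintype E]

theorem pathFlow_conservation {p : List E} {u v : V} (h : G.IsWalk u p v) (x : V) :
    ∑ e with G.tgt e = x, pathFlow R p e + (if u = x then 1 else 0) =
      ∑ e with G.src e = x, pathFlow R p e + if v = x then 1 else 0 := by
  classical
  induction p generalizing u with
  | nil => obtain rfl : u = v := h; simp [pathFlow]
  | cons a p ih =>
    obtain ⟨rfl, h⟩ := h
    have key : ∀ (P : E → Prop) [DecidablePred P], ∑ e with P e, pathFlow R (a :: p) e =
        ∑ e with P e, pathFlow R p e + if P a then 1 else 0 := by
      intro P _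
      simp only [pathFlow, List.count_cons, Nat.cast_add, Finset.sum_add_distrib]
      congr 1
      simp [Finset.sum_ite_eq]
    rw [key, key, add_right_comm _ _ (if v = x then (1 : R) else 0), ih h]

theorem isFlow_pathFlow {p : List E} (h : G.IsWalk s p t) : G.IsFlow s t (pathFlow R p) := by
  intro v hvs hvt
  simpa [hvs.symm, hvt.symm] using pathFlow_conservation (R := R) h v

theorem flowValue_pathFlow (hst : G.IsTerminalPair s t) (hne : s ≠ t) {p : List E}
    (h : G.IsWalk s p t) : G.flowValue s (pathFlow R p) = 1 := by
  have := pathFlow_conservation (R := R) h s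
  rw [Finset.filter_false_of_mem fun e _ => hst.tgt_ne e] at this
  simpa [hne.symm, flowValue] using this.symm

theorem IsFlow.add {X Y : E → R} (hX : G.IsFlow s t X) (hY : G.IsFlow s t Y) :
    G.IsFlow s t (X + Y) := by
  intro v hs ht
  simp [Finset.sum_add_distrib, hX v hs ht, hY v hs ht]

theorem IsFlow.const_mul {X : E → R} (c : R) (hX : G.IsFlow s t X) :
    G.IsFlow s t (fun e => c * X e) := by
  intro v hs ht
  simp [← Finset.mul_sum, hX v hs ht]

theorem IsFlow.sum {ι : Type*} (A : Finset ι) {X : ι → E → R}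
    (hX : ∀ i ∈ A, G.IsFlow s t (X i)) : G.IsFlow s t (fun e => ∑ i ∈ A, X i e) := by
  intro v hs ht
  rw [Finset.sum_comm, Finset.sum_comm (s := Finset.univ.filter fun e => G.src e = v)]
  exact Finset.sum_congr rfl fun i hi => hX i hi v hs ht

/-- The value of a flow is the net flow out of any set of vertices containing `s` but not `t`. -/
theorem flowValue_eq_cut [Fintype V] (hst : G.IsTerminalPair s t) {X : E → R}
    (hX : G.IsFlow s t X) (U : Finset V) (hs : s ∈ U) (ht : t ∉ U) :
    G.flowValue s X = ∑ e with G.src e ∈ U, X e - ∑ e with G.tgt e ∈ U, X e := by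
  have fib : ∀ g : E → V, ∑ e with g e ∈ U, X e = ∑ v ∈ U, ∑ e with g e = v, X e := by
    intro g
    rw [← Finset.sum_fiberwise_of_maps_to (g := g) (t := U) (by simp)]
    refine Finset.sum_congr rfl fun v hv => Finset.sum_congr ?_ fun _ _ => rfl
    ext e
    simp only [Finset.mem_filter, Finset.mem_univ, true_and]
    exact ⟨fun h => h.2, fun h => ⟨h ▸ hv, h⟩⟩
  rw [fib, fib, ← Finset.sum_sub_distrib, Finset.sum_eq_single_of_mem s hs]
  · rw [Finset.filter_false_of_mem fun e _ => hst.tgt_ne e]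
    simp [flowValue]
  · intro v hv hvs
    rw [hX v hvs fun h => ht (h ▸ hv), sub_self]

variable [LinearOrder R] [IsStrictOrderedRing R]

theorem isCovered_restrict {r : V → ℕ} (hr : G.IsRank r) (hst : G.IsTerminalPair s t)
    {X : E → R} (hX : G.IsFlow s t X) (h0 : 0 ≤ X) : (G.restrict X).IsCovered s t := by
  have key : ∀ P : E → Prop, ∀ [DecidablePred P], ∑ e with P e, X e ≠ 0 →
      ∃ f, X f ≠ 0 ∧ P f := by
    intro P _ h
    obtain ⟨f, hf, hf0⟩ := Finset.exists_ne_zero_of_sum_ne_zero h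
    exact ⟨f, hf0, (Finset.mem_filter.1 hf).2⟩
  have pos : ∀ P : E → Prop, ∀ [DecidablePred P], ∀ e, P e → X e ≠ 0 →
      ∑ e with P e, X e ≠ 0 := by
    intro P _ e he hXe
    exact ((lt_of_le_of_ne (h0 e) hXe.symm).trans_le
      (Finset.single_le_sum (f := X) (fun f _ => h0 f) (by simpa using he))).ne'
  apply Subgraph.isCovered_of_local hr
  · intro e he hes
    have := pos (fun f => G.src f = G.src e) e rfl he
    rw [← hX _ hes (hst.src_ne e)] at this
    exact key _ this
  · intro e he het
    have := pos (fun f => G.tgt f = G.tgt e) e rfl he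
    rw [hX _ (hst.tgt_ne e) het] at this
    exact key _ this

theorem flowValue_pos {r : V → ℕ} (hr : G.IsRank r) (hst : G.IsTerminalPair s t)
    {X : E → R} (hX : G.IsFlow s t X) (h0 : 0 ≤ X) (hne : X ≠ 0) : 0 < G.flowValue s X := by
  obtain ⟨e, he⟩ := Function.ne_iff.1 hne
  obtain ⟨p, hp, hep⟩ := isCovered_restrict hr hst hX h0 e he
  cases p with
  | nil => simp at hep
  | cons a p =>
    obtain ⟨ha, haX, -⟩ := Subgraph.isPath_cons.1 hp
    exact (lt_of_le_of_ne (h0 a) (Ne.symm haX)).trans_le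
      (Finset.single_le_sum (f := X) (fun f _ => h0 f) (by simpa using ha))

/-- Choose an `s`-`t` path through each edge and add up the unit flows. This turns covered subgraphs
into supports of flows over any ordered ring. -/
theorem Subgraph.IsCovered.exists_flow {H : G.Subgraph} (h : H.IsCovered s t) :
    ∃ X : E → R, G.IsFlow s t X ∧ 0 ≤ X ∧ ∀ e, X e ≠ 0 ↔ e ∈ H.edges := by
  classical
  have : ∀ e : H.edges, ∃ p, H.IsPath s p t ∧ e.1 ∈ p := fun e => h e.1 e.2
  choose p hp hep using this
  refine ⟨fun e => ∑ f : H.edges, pathFlow R (p f) e,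
    IsFlow.sum _ fun f _ => isFlow_pathFlow (hp f).1,
    fun e => Finset.sum_nonneg fun f _ => pathFlow_nonneg _ _, fun e => ⟨fun hX => ?_, fun he => ?_⟩⟩
  · obtain ⟨f, -, hf⟩ := Finset.exists_ne_zero_of_sum_ne_zero hX
    exact (hp f).2 e (by_contra fun h => hf (pathFlow_eq_zero h))
  · have h1 : 0 < pathFlow R (p ⟨e, he⟩) e :=
      Nat.cast_pos.2 (List.count_pos_iff.2 (hep ⟨e, he⟩))
    exact (h1.trans_le (Finset.single_le_sum (f := fun f => pathFlow R (p f) e)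
      (fun f _ => pathFlow_nonneg _ _) (Finset.mem_univ _))).ne'

/-- Width-stability does not depend on the ring of flow values: it is about sets of edges. -/
theorem WidthStable.width_le (h : G.WidthStable R s t) {H K : G.Subgraph}
    (hH : H.IsCovered s t) (hK : K.IsCovered s t) (hHK : H.edges ⊆ K.edges) :
    H.width s t ≤ K.width s t := by
  obtain ⟨X, hX, hX0, hXH⟩ := hH.exists_flow (R := R)
  obtain ⟨Y, hY, hY0, hYK⟩ := hK.exists_flow (R := R)
  -- `Y` need not dominate `X`, but `X + Y` does, and its support is still that of `Y`.
  have key := h X (X + Y) hX (hX.add hY) hX0 (le_add_of_nonneg_right hY0)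
  have e₁ : (G.restrict X).edges = H.edges := Set.ext hXH
  have e₂ : (G.restrict (X + Y)).edges = K.edges := by
    ext e
    rw [← hYK e]
    have h1 : 0 ≤ X e := hX0 e
    have h2 : 0 ≤ Y e := hY0 e
    have h3 := hXH e
    have h4 := hYK e
    change X e + Y e ≠ 0 ↔ _
    constructor
    · intro h hY
      have : X e ≠ 0 := by rwa [hY, add_zero] at h
      exact h4.2 (hHK (h3.1 this)) hY
    · intro h
      exact (add_pos_of_nonneg_of_pos h1 (lt_of_le_of_ne h2 h.symm)).ne'
  have w : ∀ A B : G.Subgraph, A.edges = B.edges → A.width s t = B.width s t := by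
    intro A B hAB
    simp only [Subgraph.width, Subgraph.IsPath, hAB]
  rwa [w _ _ e₁, w _ _ e₂] at key

/-- Width-stable graphs have paths of large weight. -/
theorem WidthStable.hasPathsOfLargeWeight [Fintype V] {r : V → ℕ} (hr : G.IsRank r)
    (hst : G.IsTerminalPair s t) (h : G.WidthStable R s t) : G.HasPathsOfLargeWeight R s t := by
  classical
  intro X hX h0 hne
  have hcov := isCovered_restrict hr hst hX h0
  have hpos := flowValue_pos hr hst hX h0 hne
  set B := G.restrict X with hB
  set w := B.width s t with hw
  set c := G.flowValue s X with hc
  by_contra hcon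
  push Not at hcon
  -- `U` is what heavy edges reach from `s`; `T` is what reaches `t` without an edge starting in
  -- `U`. Cutting at `T` rather than at the complement of `U` ensures that from the head of a cut
  -- edge one can go on to `t` without returning to `U`.
  let U : Set V := {x | ∃ p, B.IsPath s p x ∧ ∀ e ∈ p, c ≤ (w : R) * X e}
  have hsU : s ∈ U := ⟨[], Subgraph.isPath_nil, by simp⟩
  have htU : t ∉ U := by
    rintro ⟨p, hp, hbig⟩
    obtain ⟨e, he, hlt⟩ := hcon p hp
    exact absurd (hbig e he) (not_le.2 hlt)
  let T : Set V := {x | ∃ p, B.IsPath x p t ∧ ∀ e ∈ p, G.src e ∉ U}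
  have htT : t ∈ T := ⟨[], Subgraph.isPath_nil, by simp⟩
  have hTU : ∀ x ∈ T, x ∉ U := by
    rintro x ⟨p, hp, hpU⟩
    cases p with
    | nil => rwa [show x = t from hp.1]
    | cons a p => exact (Subgraph.isPath_cons.1 hp).1 ▸ hpU a List.mem_cons_self
  let K : Finset E := Finset.univ.filter fun e => X e ≠ 0 ∧ G.src e ∉ T ∧ G.tgt e ∈ T
  have hKU : ∀ e ∈ K, G.src e ∈ U := by
    intro e he
    obtain ⟨-, heX, hsrc, p, hp, hpU⟩ := Finset.mem_filter.1 he
    by_contra hU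
    exact hsrc ⟨e :: p, Subgraph.isPath_cons.2 ⟨rfl, heX, hp⟩, List.forall_mem_cons.2 ⟨hU, hpU⟩⟩
  have hsmall : ∀ e ∈ K, (w : R) * X e < c := by
    intro e he
    obtain ⟨p, hp, hbig⟩ := hKU e he
    obtain ⟨-, heX, hsrc, htgt⟩ := Finset.mem_filter.1 he
    by_contra hge
    refine hTU _ htgt ⟨p ++ [e], Subgraph.isPath_append.2
      ⟨_, hp, Subgraph.isPath_cons.2 ⟨rfl, heX, Subgraph.isPath_nil⟩⟩, ?_⟩
    intro f hf
    rcases List.mem_append.1 hf with hf | hf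
    · exact hbig f hf
    · rw [List.mem_singleton.1 hf]
      exact not_lt.1 hge
  -- The value is the net flow into `T`, and flow leaving `T` only lowers it.
  have hcut : c ≤ ∑ e ∈ K, X e := by
    have hU' : ∀ x, x ∈ (Finset.univ.filter fun x => x ∉ T) ↔ x ∉ T := by simp
    have := flowValue_eq_cut hst hX (Finset.univ.filter fun x => x ∉ T)
      ((hU' s).2 fun h => hTU s h hsU) (fun h => (hU' t).1 h htT)
    rw [hc, this, sub_le_iff_le_add]
    simp only [hU']
    rw [Finset.sum_filter, Finset.sum_filter, Finset.sum_filter, ← Finset.sum_add_distrib]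
    refine Finset.sum_le_sum fun e _ => ?_
    have := h0 e
    simp only [Pi.zero_apply] at this
    by_cases h1 : G.src e ∈ T <;> by_cases h2 : G.tgt e ∈ T <;> by_cases h3 : X e = 0 <;>
      simp [h1, h2, h3, this]
  have hcard : w < K.card := by
    by_contra hle
    rw [not_lt] at hle
    have h1 : (w : R) * c ≤ ∑ e ∈ K, (w : R) * X e := by
      rw [← Finset.mul_sum]
      exact mul_le_mul_of_nonneg_left hcut (Nat.cast_nonneg _)
    rcases K.eq_empty_or_nonempty with hK | hK
    · rw [hK, Finset.sum_empty] at hcut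
      exact absurd hcut (not_le.2 hpos)
    · have h2 : ∑ e ∈ K, (w : R) * X e < ∑ e ∈ K, c := Finset.sum_lt_sum_of_nonempty hK hsmall
      rw [Finset.sum_const, nsmul_eq_mul] at h2
      have h3 : (K.card : R) * c ≤ w * c :=
        mul_le_mul_of_nonneg_right (Nat.cast_le.2 hle) hpos.le
      exact absurd (h1.trans_lt h2) (not_lt.2 h3)
  have hp : ∀ e ∈ K, ∃ p, B.IsPath s p (G.src e) ∧ ∀ f ∈ p, c ≤ (w : R) * X f := hKU
  have hq : ∀ e ∈ K, ∃ q, B.IsPath (G.tgt e) q t ∧ ∀ f ∈ q, G.src f ∉ U :=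
    fun e he => (Finset.mem_filter.1 he).2.2.2
  choose! p hp hpbig using hp
  choose! q hq hqU using hq
  -- Each path goes heavily inside `U`, crosses by its edge of `K` and then avoids `U`. So the
  -- complement of `U` is closed in `A`, though perhaps not in `B`.
  let A : G.Subgraph :=
    { verts := Set.univ
      edges := {f | ∃ e ∈ K, f ∈ p e ++ e :: q e}
      src_mem := fun _ _ => trivial
      tgt_mem := fun _ _ => trivial }
  have hpath : ∀ e ∈ K, B.IsPath s (p e ++ e :: q e) t := fun e he => Subgraph.isPath_append.2
    ⟨_, hp e he, Subgraph.isPath_cons.2 ⟨rfl, (Finset.mem_filter.1 he).2.1, hq e he⟩⟩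
  have hAcov : A.IsCovered s t := by
    rintro f ⟨e, he, hf⟩
    exact ⟨_, ⟨(hpath e he).1, fun g hg => ⟨e, he, hg⟩⟩, hf⟩
  have hAB : A.edges ⊆ B.edges := by
    rintro f ⟨e, he, hf⟩
    exact (hpath e he).2 f hf
  have hD : A.IsClosedSet Uᶜ := by
    rintro f ⟨e, he, hf⟩ hfU
    rcases List.mem_append.1 hf with hf | hf
    · obtain ⟨a, b, hab⟩ := List.append_of_mem hf
      have h1 := hp e he
      rw [hab] at h1
      obtain ⟨v, h1, h2⟩ := Subgraph.isPath_append.1 h1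
      refine absurd ⟨a, (Subgraph.isPath_cons.1 h2).1 ▸ h1, fun g hg => hpbig e he g ?_⟩ hfU
      rw [hab]
      exact List.mem_append_left _ hg
    · rcases List.mem_cons.1 hf with rfl | hf
      · exact hTU _ (Finset.mem_filter.1 he).2.2.2
      · obtain ⟨a, b, hab⟩ := List.append_of_mem hf
        have h1 := hq e he
        rw [hab] at h1
        obtain ⟨v, -, h2⟩ := Subgraph.isPath_append.1 h1
        refine hTU _ ⟨b, (Subgraph.isPath_cons.1 h2).2.2, fun g hg => hqU e he g ?_⟩
        rw [hab]
        exact List.mem_append_right _ (List.mem_cons_of_mem _ hg)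
  have h1 := hAcov.card_le_width hD K fun e he => ⟨⟨e, he, by simp⟩, not_not.2 (hKU e he),
    hTU _ (Finset.mem_filter.1 he).2.2.2⟩
  have h2 := h.width_le hAcov hcov hAB
  omega

end MultiDigraph

/-! ### Paths of large weight exclude central paths. -/

namespace MultiDigraph

variable {V E : Type*} {G : MultiDigraph V E} {s t : V} {r : V → ℕ}

theorem Subgraph.IsMerging.exists_ne [Finite E] {F : G.Subgraph} {u : V} (h : F.IsMerging u) :
    ∃ a ∈ F.edges, ∃ b ∈ F.edges, G.tgt a = u ∧ G.tgt b = u ∧ a ≠ b := by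
  obtain ⟨a, b, ha, hb, hab⟩ := (Set.one_lt_ncard_iff (Set.toFinite _)).1 h
  exact ⟨a, ha.1, b, hb.1, ha.2, hb.2, hab⟩

theorem Subgraph.IsForking.exists_ne [Finite E] {F : G.Subgraph} {v : V} (h : F.IsForking v) :
    ∃ a ∈ F.edges, ∃ b ∈ F.edges, G.src a = v ∧ G.src b = v ∧ a ≠ b := by
  obtain ⟨a, b, ha, hb, hab⟩ := (Set.one_lt_ncard_iff (Set.toFinite _)).1 h
  exact ⟨a, ha.1, b, hb.1, ha.2, hb.2, hab⟩

theorem Subgraph.IsSTDag.isCovered [Finite E] {F : G.Subgraph} (hr : G.IsRank r) (hF : F.IsSTDag s t) :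
    F.IsCovered s t := by
  apply Subgraph.isCovered_of_local hr
  · intro e he hes
    by_contra! h
    exact hes ((hF.source_iff _ (F.src_mem e he)).1 h)
  · intro e he het
    by_contra! h
    exact het ((hF.sink_iff _ (F.tgt_mem e he)).1 h)

theorem Subgraph.finite_paths [Finite E] (hr : G.IsRank r) (F : G.Subgraph) :
    {p | F.IsPath s p t}.Finite :=
  (List.finite_length_le E (r t)).subset fun p hp => by
    have := hr.le_of_isWalk hp.1
    simp only [Set.mem_ofPred_eq]
    omega

/-- In a funnel, no path leads from two in-edges of a vertex to two out-edges of a vertex. -/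
theorem Subgraph.IsFunnel.not_merge_fork {F : G.Subgraph} (hF : F.IsFunnel s t)
    {A₁ A₂ B D₁ D₂ : List E} {u v : V} (hA₁ : F.IsPath s A₁ u) (hA₂ : F.IsPath s A₂ u)
    (hB : F.IsPath u B v) (hD₁ : F.IsPath v D₁ t) (hD₂ : F.IsPath v D₂ t)
    (hA : A₁ ≠ A₂) (hD : D₁ ≠ D₂) : False := by
  have join : ∀ {X Y : List E}, F.IsPath s X u → F.IsPath v Y t → F.IsPath s (X ++ (B ++ Y)) t :=
    fun hX hY => isPath_append.2 ⟨_, hX, isPath_append.2 ⟨_, hB, hY⟩⟩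
  -- A private edge in `A₁` is shared after exchanging `D₁` for `D₂`; one in `B` or `D₁` is shared
  -- after exchanging `A₁` for `A₂`.
  obtain ⟨e, he, huniq⟩ := hF.2 _ (join hA₁ hD₁)
  rcases List.mem_append.1 he with he | he
  · have := huniq _ (join hA₁ hD₂) (List.mem_append_left _ he)
    simp only [List.append_cancel_left_eq] at this
    exact hD this.symm
  · have := huniq _ (join hA₂ hD₁) (List.mem_append_right _ he)
    simp only [List.append_cancel_right_eq] at this
    exact hA this.symm

/-- In a funnel with a central path, no path contains both the merging and the forking node. -/
theorem Subgraph.IsFunnel.append_ne (hr : G.IsRank r) {F : G.Subgraph} (hF : F.IsFunnel s t)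
    {A₁ A₂ B C D₁ D₂ p : List E} {u v : V} (hA₁ : F.IsPath s A₁ u) (hA₂ : F.IsPath s A₂ u)
    (hB : F.IsPath u B t) (hC : F.IsPath s C v) (hD₁ : F.IsPath v D₁ t) (hD₂ : F.IsPath v D₂ t)
    (hA : A₁ ≠ A₂) (hD : D₁ ≠ D₂) (hp : G.IsWalk u p v) : A₁ ++ B ≠ C ++ D₁ := by
  intro h
  -- Either `u` comes first, giving a path of `F` from `u` to `v`, or `v` does, and then `p` closes
  -- a cycle unless `u = v`.
  rcases List.append_eq_append_iff.1 h with ⟨z, rfl, rfl⟩ | ⟨z, rfl, rfl⟩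
  · obtain ⟨w, hz, hz'⟩ := isPath_append.1 hC
    obtain rfl : w = u := hz.1.eq_target hA₁.1
    exact hF.not_merge_fork hA₁ hA₂ hz' hD₁ hD₂ hA hD
  · obtain ⟨w, hz, hz'⟩ := isPath_append.1 hA₁
    obtain rfl : w = v := hz.1.eq_target hC.1
    have := hr.eq_nil (isWalk_append.2 ⟨_, hz'.1, hp⟩)
    obtain ⟨rfl, rfl⟩ := List.append_eq_nil_iff.1 this
    obtain rfl : w = u := hz'.1
    exact hF.not_merge_fork hA₁ hA₂ isPath_nil hD₁ hD₂ hA hD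

variable [DecidableEq V] [Fintype E] {R : Type*} [CommRing R] [LinearOrder R] [IsStrictOrderedRing R]

/-- Graphs with paths of large weight have no funnel subgraph with a central path. -/
theorem HasPathsOfLargeWeight.not_isCentralPath (hr : G.IsRank r) (hst : G.IsTerminalPair s t)
    (h : G.HasPathsOfLargeWeight R s t) {F : G.Subgraph} (hF : F.IsFunnel s t) {c : List E} :
    ¬ F.IsCentralPath c := by
  classical
  rintro ⟨u, v, hu, hv, hc⟩
  have hcov := hF.1.isCovered hr
  obtain ⟨a₁, ha₁, a₂, ha₂, hau₁, hau₂, hane⟩ := hu.exists_ne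
  obtain ⟨d₁, hd₁, d₂, hd₂, hdv₁, hdv₂, hdne⟩ := hv.exists_ne
  obtain ⟨A₁, B, hA₁, hB⟩ := hcov.exists_paths ha₁
  obtain ⟨A₂, -, hA₂, -⟩ := hcov.exists_paths ha₂
  obtain ⟨C, D₁, hC, hD₁⟩ := hcov.exists_paths hd₁
  obtain ⟨-, D₂, -, hD₂⟩ := hcov.exists_paths hd₂
  rw [hau₁] at hB
  rw [hdv₁] at hC
  have snoc : ∀ {X : List E} {a : E}, F.IsPath s X (G.src a) → a ∈ F.edges → G.tgt a = u →
      F.IsPath s (X ++ [a]) u := fun hX ha hau =>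
    Subgraph.isPath_append.2 ⟨_, hX, Subgraph.isPath_cons.2 ⟨rfl, ha, hau ▸ Subgraph.isPath_nil⟩⟩
  replace hA₁ := snoc hA₁ ha₁ hau₁
  replace hA₂ := snoc hA₂ ha₂ hau₂
  replace hD₁ : F.IsPath v (d₁ :: D₁) t := Subgraph.isPath_cons.2 ⟨hdv₁, hd₁, hD₁⟩
  replace hD₂ : F.IsPath v (d₂ :: D₂) t := Subgraph.isPath_cons.2 ⟨hdv₂, hd₂, hD₂⟩
  have hA : A₁ ++ [a₁] ≠ A₂ ++ [a₂] := fun h => hane (by simpa using (List.append_inj' h rfl).2)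
  have hD : d₁ :: D₁ ≠ d₂ :: D₂ := fun h => hdne (List.cons.inj h).1
  generalize A₁ ++ [a₁] = A₁ at *
  generalize A₂ ++ [a₂] = A₂ at *
  generalize d₁ :: D₁ = D₁ at *
  generalize d₂ :: D₂ = D₂ at *
  have hP₁ : F.IsPath s (A₁ ++ B) t := Subgraph.isPath_append.2 ⟨_, hA₁, hB⟩
  have hP₂ : F.IsPath s (A₂ ++ B) t := Subgraph.isPath_append.2 ⟨_, hA₂, hB⟩
  have hQ₁ : F.IsPath s (C ++ D₁) t := Subgraph.isPath_append.2 ⟨_, hC, hD₁⟩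
  have hQ₂ : F.IsPath s (C ++ D₂) t := Subgraph.isPath_append.2 ⟨_, hC, hD₂⟩
  have hPP : A₂ ++ B ≠ A₁ ++ B := fun h => hA (by simpa using h.symm)
  have hQQ : C ++ D₂ ≠ C ++ D₁ := fun h => hD (by simpa using h.symm)
  have hP₁Q₁ := hF.append_ne hr hA₁ hA₂ hB hC hD₁ hD₂ hA hD hc
  have hP₂Q₁ := hF.append_ne hr hA₂ hA₁ hB hC hD₁ hD₂ hA.symm hD hc
  have hP₁Q₂ := hF.append_ne hr hA₁ hA₂ hB hC hD₂ hD₁ hA hD.symm hc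
  have hq : G.IsWalk s (A₁ ++ (c ++ D₁)) t :=
    isWalk_append.2 ⟨_, hA₁.1, isWalk_append.2 ⟨_, hc, hD₁.1⟩⟩
  set q := A₁ ++ (c ++ D₁) with hqdef
  have hne : s ≠ t := by
    rintro rfl
    obtain ⟨e, he, -⟩ := hF.2 [] Subgraph.isPath_nil
    simp at he
  let paths := (F.finite_paths (s := s) (t := t) hr).toFinset
  have mem_paths : ∀ {p}, p ∈ paths ↔ F.IsPath s p t := by simp [paths]
  set k := paths.card with hk
  let Y : E → R := fun e => ∑ p ∈ paths, pathFlow R p e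
  have hY : G.IsFlow s t Y := IsFlow.sum _ fun p hp => isFlow_pathFlow (mem_paths.1 hp).1
  -- The factor `k` makes the extra unit negligible: with factor `m` the final comparison is `(k -
  -- 1)(m + 1) < m * k + 1`, which needs `m > k - 2`.
  let X : E → R := (fun e => (k : R) * Y e) + pathFlow R q
  have hXe : ∀ e, X e = k * Y e + pathFlow R q e := fun e => rfl
  have hX : G.IsFlow s t X := (hY.const_mul _).add (isFlow_pathFlow hq)
  have hY0 : ∀ e, 0 ≤ Y e := fun e => Finset.sum_nonneg fun p _ => pathFlow_nonneg _ _
  have hX0 : ∀ e, 0 ≤ X e := fun e =>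
    add_nonneg (mul_nonneg (Nat.cast_nonneg _) (hY0 e)) (pathFlow_nonneg _ _)
  have hYval : G.flowValue s Y = k := by
    have : G.flowValue s Y = ∑ p ∈ paths, G.flowValue s (pathFlow R p) := Finset.sum_comm
    rw [this, Finset.sum_congr rfl fun p hp => flowValue_pathFlow hst hne (mem_paths.1 hp).1]
    simp [hk]
  have hXval : G.flowValue s X = k * k + 1 := by
    rw [← flowValue_pathFlow (R := R) hst hne hq]
    nth_rewrite 2 [← hYval]
    simp only [flowValue, Finset.mul_sum, ← Finset.sum_add_distrib]
    rfl
  have hXne : X ≠ 0 := by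
    intro h0
    rw [h0] at hXval
    simp only [flowValue, Pi.zero_apply, Finset.sum_const_zero] at hXval
    have : (0 : R) < k * k + 1 := by positivity
    exact this.ne hXval
  have hqle : ∀ e, pathFlow R q e ≤ 1 := by
    intro e
    by_cases he : e ∈ q
    · exact (pathFlow_eq_one hr hq he).le
    · rw [pathFlow_eq_zero he]
      exact zero_le_one
  have hYout : ∀ e ∉ F.edges, Y e = 0 := fun e he =>
    Finset.sum_eq_zero fun p hp => pathFlow_eq_zero fun hep => he ((mem_paths.1 hp).2 e hep)
  have hYin : ∀ e ∈ F.edges, 0 < Y e := by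
    intro e he
    obtain ⟨p, hp, hep⟩ := hcov e he
    refine lt_of_lt_of_le zero_lt_one ?_
    rw [← pathFlow_eq_one (R := R) hr hp.1 hep]
    exact Finset.single_le_sum (f := fun p => pathFlow R p e)
      (fun p _ => pathFlow_nonneg _ _) (mem_paths.2 hp)
  have hkpos : 0 < k := Finset.card_pos.2 ⟨_, mem_paths.2 hP₁⟩
  have hsupp : ∀ e, X e ≠ 0 ↔ e ∈ F.edges ∨ e ∈ q := by
    intro e
    rw [hXe]
    constructor
    · contrapose!
      rintro ⟨h1, h2⟩
      rw [hYout e h1, pathFlow_eq_zero h2, mul_zero, add_zero]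
    · rintro (h1 | h1)
      · have : (0 : R) < k * Y e := mul_pos (Nat.cast_pos.2 hkpos) (hYin e h1)
        exact (add_pos_of_pos_of_nonneg this (pathFlow_nonneg _ _)).ne'
      · rw [pathFlow_eq_one hr hq h1]
        exact (add_pos_of_nonneg_of_pos (mul_nonneg (Nat.cast_nonneg _) (hY0 e)) one_pos).ne'
  have hwidth : (G.restrict X).width s t + 1 ≤ k := by
    -- Of the two dropped paths, `q` covers `A₁` and `D₁`, while `A₂ ++ B` covers `B` and `C ++ D₂`
    -- covers `C`.
    let cover := insert q ((paths.erase (A₁ ++ B)).erase (C ++ D₁))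
    have hle : (G.restrict X).width s t ≤ cover.card := by
      apply Subgraph.width_le_card
      · intro p hp
        rcases Finset.mem_insert.1 hp with rfl | hp
        · exact ⟨hq, fun e he => (hsupp e).2 (Or.inr he)⟩
        · have := mem_paths.1 (Finset.mem_of_mem_erase (Finset.mem_of_mem_erase hp))
          exact ⟨this.1, fun e he => (hsupp e).2 (Or.inl (this.2 e he))⟩
      · intro e he
        have old : ∀ p, F.IsPath s p t → p ≠ A₁ ++ B → p ≠ C ++ D₁ → e ∈ p → ∃ p ∈ cover, e ∈ p :=
          fun p hp h1 h2 hep => ⟨p, Finset.mem_insert_of_mem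
            (Finset.mem_erase.2 ⟨h2, Finset.mem_erase.2 ⟨h1, mem_paths.2 hp⟩⟩), hep⟩
        have new : e ∈ q → ∃ p ∈ cover, e ∈ p := fun hep => ⟨q, Finset.mem_insert_self _ _, hep⟩
        rcases (hsupp e).1 he with he | he
        · obtain ⟨p, hp, hep⟩ := hcov e he
          by_cases h1 : p = A₁ ++ B
          · rw [h1] at hep
            rcases List.mem_append.1 hep with hep | hep
            · exact new (List.mem_append_left _ hep)
            · exact old _ hP₂ hPP hP₂Q₁ (List.mem_append_right _ hep)
          by_cases h2 : p = C ++ D₁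
          · rw [h2] at hep
            rcases List.mem_append.1 hep with hep | hep
            · exact old _ hQ₂ hP₁Q₂.symm hQQ (List.mem_append_left _ hep)
            · exact new (List.mem_append_right _ (List.mem_append_right _ hep))
          exact old p hp h1 h2 hep
        · exact new he
    have hcard := Finset.card_insert_le q ((paths.erase (A₁ ++ B)).erase (C ++ D₁))
    have h1 : ((paths.erase (A₁ ++ B)).erase (C ++ D₁)).card + 1 = (paths.erase (A₁ ++ B)).card :=
      Finset.card_erase_add_one (Finset.mem_erase.2 ⟨hP₁Q₁.symm, mem_paths.2 hQ₁⟩)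
    have h2 : (paths.erase (A₁ ++ B)).card + 1 = k := Finset.card_erase_add_one (mem_paths.2 hP₁)
    change (G.restrict X).width s t ≤ (insert q ((paths.erase (A₁ ++ B)).erase (C ++ D₁))).card at hle
    omega
  obtain ⟨p, hp, hpbig⟩ := h X hX hX0 hXne
  -- If `p` lies in `F`, its private edge has `Y e = 1`; otherwise an edge outside `F` carries only
  -- the unit of `q`.
  obtain ⟨e, hep, hesmall⟩ : ∃ e ∈ p, X e ≤ k + 1 := by
    by_cases hpF : ∀ e ∈ p, e ∈ F.edges
    · obtain ⟨e, hep, hpriv⟩ := hF.2 p ⟨hp.1, hpF⟩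
      refine ⟨e, hep, ?_⟩
      have : Y e = 1 := by
        rw [← pathFlow_eq_one (R := R) hr hp.1 hep]
        refine Finset.sum_eq_single_of_mem p (mem_paths.2 ⟨hp.1, hpF⟩) fun p' hp' hne' => ?_
        exact pathFlow_eq_zero fun he' => hne' (hpriv p' (mem_paths.1 hp') he')
      rw [hXe, this, mul_one]
      exact add_le_add_right (hqle e) _
    · push Not at hpF
      obtain ⟨e, hep, heF⟩ := hpF
      refine ⟨e, hep, ?_⟩
      rw [hXe, hYout e heF, mul_zero]
      exact add_le_add (Nat.cast_nonneg _) (hqle e)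
  have h1 := hpbig e hep
  have h2 : ((G.restrict X).width s t : R) + 1 ≤ k := by exact_mod_cast hwidth
  have h3 : ((G.restrict X).width s t : R) * X e ≤ (G.restrict X).width s t * (k + 1) :=
    mul_le_mul_of_nonneg_left hesmall (Nat.cast_nonneg _)
  have h4 : ((G.restrict X).width s t : R) * (k + 1) ≤ (k - 1) * (k + 1) :=
    mul_le_mul_of_nonneg_right (by linarith) (by positivity)
  rw [hXval] at h1
  linarith

end MultiDigraph

/-! ### Excluding central paths gives width-stability. -/

namespace MultiDigraph

variable {V E : Type*} {G : MultiDigraph V E} {s t : V} {r : V → ℕ}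

namespace Subgraph

variable {H : G.Subgraph}

/-- The edge `f` can be reached in `H` from the head of the edge `e`. -/
def Precedes (H : G.Subgraph) (e f : E) : Prop := ∃ p, H.IsPath (G.tgt e) p (G.src f)

theorem Precedes.rank_lt (hr : G.IsRank r) {e f : E} (h : H.Precedes e f) :
    r (G.src e) < r (G.src f) := by
  obtain ⟨p, hp⟩ := h
  have h₁ := hr.le_of_isWalk hp.1
  have h₂ := hr e
  omega

theorem IsPath.comparable {p : List E} {u v : V} (hp : H.IsPath u p v) {e f : E} (he : e ∈ p)
    (hf : f ∈ p) : e = f ∨ H.Precedes e f ∨ H.Precedes f e := by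
  induction p generalizing u with
  | nil => simp at he
  | cons a p ih =>
    obtain ⟨-, haH, hp⟩ := isPath_cons.1 hp
    have key : ∀ g ∈ p, H.Precedes a g := by
      intro g hg
      obtain ⟨x, y, rfl⟩ := List.append_of_mem hg
      obtain ⟨w, h₁, h₂⟩ := isPath_append.1 hp
      exact ⟨x, (isPath_cons.1 h₂).1 ▸ h₁⟩
    rcases List.mem_cons.1 he with rfl | he' <;> rcases List.mem_cons.1 hf with rfl | hf'
    · exact Or.inl rfl
    · exact Or.inr (Or.inl (key _ hf'))
    · exact Or.inr (Or.inr (key _ he'))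
    · exact ih hp he' hf'

/-- Peel off the chain edge `a` of greatest rank: the others precede it, so they lie on a path to
its tail. The varying endpoint `x` serves this induction. -/
theorem IsCovered.exists_path_of_chain (hr : G.IsRank r) (hH : H.IsCovered s t) (c : Finset E)
    (hc : ∀ e ∈ c, e ∈ H.edges)
    (hchain : ∀ e ∈ c, ∀ f ∈ c, e ≠ f → H.Precedes e f ∨ H.Precedes f e) (x : V)
    (hx : ∃ p, H.IsPath s p x) (hcx : ∀ e ∈ c, ∃ p, H.IsPath (G.tgt e) p x) :
    ∃ p, H.IsPath s p x ∧ ∀ e ∈ c, e ∈ p := by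
  classical
  induction c using Finset.induction_on_max_value (fun e => r (G.src e)) generalizing x with
  | empty =>
    obtain ⟨p, hp⟩ := hx
    exact ⟨p, hp, by simp⟩
  | insert a c hac hmax ih =>
    obtain ⟨p₀, -, hp₀, -⟩ := hH.exists_paths (hc a (Finset.mem_insert_self _ _))
    obtain ⟨p, hp, hpc⟩ := ih (fun e he => hc e (Finset.mem_insert_of_mem he))
      (fun e he f hf => hchain e (Finset.mem_insert_of_mem he) f (Finset.mem_insert_of_mem hf))
      (G.src a) ⟨p₀, hp₀⟩ (fun e he => by
        rcases hchain e (Finset.mem_insert_of_mem he) a (Finset.mem_insert_self _ _)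
          (fun h => hac (h ▸ he)) with h | h
        · exact h
        · exact absurd (h.rank_lt hr) (not_lt.2 (hmax e he)))
    obtain ⟨q, hq⟩ := hcx a (Finset.mem_insert_self _ _)
    refine ⟨p ++ a :: q, isPath_append.2
      ⟨_, hp, isPath_cons.2 ⟨rfl, hc a (Finset.mem_insert_self _ _), hq⟩⟩, fun e he => ?_⟩
    rcases Finset.mem_insert.1 he with rfl | he
    · simp
    · exact List.mem_append_left _ (hpc e he)

/-- There are as many pairwise unreachable edges as paths needed to cover all edges. -/
theorem IsCovered.exists_antichain [Finite E] (hr : G.IsRank r) (hH : H.IsCovered s t) :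
    ∃ C : Finset E, (∀ e ∈ C, e ∈ H.edges) ∧ (∀ e ∈ C, ∀ f ∈ C, ¬ H.Precedes e f) ∧
      H.width s t ≤ C.card := by
  classical
  have hfin := Set.toFinite H.edges
  obtain ⟨C, hCS, hC, f, hfC, hf⟩ := exists_antichain_chain_coloring
    (fun e f => e ∈ H.edges ∧ f ∈ H.edges ∧ H.Precedes e f) (fun e => r (G.src e))
    (by
      rintro x y z ⟨hx, hy, p, hp⟩ ⟨-, hz, q, hq⟩
      exact ⟨hx, hz, p ++ y :: q, isPath_append.2 ⟨_, hp, isPath_cons.2 ⟨rfl, hy, hq⟩⟩⟩)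
    (fun e f h => h.2.2.rank_lt hr) hfin.toFinset
  have hCH : ∀ e ∈ C, e ∈ H.edges := fun e he => by simpa using hCS he
  refine ⟨C, hCH, fun e he f hf h => hC e he f hf ⟨hCH e he, hCH f hf, h⟩, ?_⟩
  rcases C.eq_empty_or_nonempty with rfl | ⟨e₀, he₀⟩
  · refine width_le (fun i => i.elim0) (fun i => i.elim0) fun e he => ?_
    exact absurd (hfC e (by simpa using he)) (by simp)
  -- Needed for colour classes that are empty.
  have hst : ∃ p, H.IsPath s p t := (hH e₀ (hCH e₀ he₀)).imp fun _ h => h.1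
  have : ∀ i : Fin C.card, ∃ p, H.IsPath s p t ∧
      ∀ e ∈ hfin.toFinset.filter (fun e => f e = i), e ∈ p := by
    intro i
    apply hH.exists_path_of_chain hr _ _ _ _ hst
    · intro e he
      obtain ⟨-, q, -, hq⟩ := hH.exists_paths (by simpa using (Finset.mem_filter.1 he).1)
      exact ⟨q, hq⟩
    · intro e he
      simpa using (Finset.mem_filter.1 he).1
    · intro e he e' he' hne
      obtain ⟨he₁, he₂⟩ := Finset.mem_filter.1 he
      obtain ⟨he₁', he₂'⟩ := Finset.mem_filter.1 he'
      exact (hf e he₁ e' he₁' (he₂.trans he₂'.symm) hne).imp (fun h => h.2.2) fun h => h.2.2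
  choose P hP hPe using this
  refine width_le P hP fun e he => ?_
  have heS : e ∈ hfin.toFinset := by simpa using he
  exact ⟨⟨f e, hfC e heS⟩, hPe _ e (Finset.mem_filter.2 ⟨heS, rfl⟩)⟩

/-- Through pairwise unreachable edges there is a funnel. -/
theorem IsCovered.exists_isFunnel [Finite E] (hr : G.IsRank r) (hst : G.IsTerminalPair s t)
    (hH : H.IsCovered s t) {C : Finset E} (hCne : C.Nonempty) (hCH : ∀ e ∈ C, e ∈ H.edges)
    (hC : ∀ e ∈ C, ∀ f ∈ C, ¬ H.Precedes e f) :
    ∃ F : G.Subgraph, F.IsFunnel s t ∧ F.edges ⊆ H.edges ∧ ∀ e ∈ C, e ∈ F.edges := by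
  obtain ⟨e₀, he₀⟩ := hCne
  -- One in-edge and one out-edge are fixed per vertex; where none is needed, `e₀` is a dummy.
  have hpred : ∀ x, ∃ f, ∀ e ∈ H.edges, G.src e = x → x ≠ s → f ∈ H.edges ∧ G.tgt f = x := by
    intro x
    by_cases hx : ∃ e ∈ H.edges, G.src e = x ∧ x ≠ s
    · obtain ⟨e, he, rfl, hes⟩ := hx
      obtain ⟨p, -, hp, -⟩ := hH.exists_paths he
      rcases List.eq_nil_or_concat p with rfl | ⟨p, f, rfl⟩
      · exact absurd hp.1.symm hes
      · rw [List.concat_eq_append] at hp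
        obtain ⟨w, -, hf⟩ := isPath_append.1 hp
        obtain ⟨-, hfH, hf⟩ := isPath_cons.1 hf
        exact ⟨f, fun _ _ _ _ => ⟨hfH, hf.1⟩⟩
    · push Not at hx
      exact ⟨e₀, fun e he hex hxs => absurd (hx e he hex) hxs⟩
  have hsucc : ∀ x, ∃ f, ∀ e ∈ H.edges, G.tgt e = x → x ≠ t → f ∈ H.edges ∧ G.src f = x := by
    intro x
    by_cases hx : ∃ e ∈ H.edges, G.tgt e = x ∧ x ≠ t
    · obtain ⟨e, he, rfl, het⟩ := hx
      obtain ⟨-, p, -, hp⟩ := hH.exists_paths he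
      cases p with
      | nil => exact absurd hp.1 het
      | cons f p => exact ⟨f, fun _ _ _ _ => ⟨(isPath_cons.1 hp).2.1, (isPath_cons.1 hp).1⟩⟩
    · push Not at hx
      exact ⟨e₀, fun e he hex hxt => absurd (hx e he hex) hxt⟩
  choose pe hpe using hpred
  choose se hse using hsucc
  -- `L` collects the vertices traced back from tails of `C` along `pe`, and `M` those traced
  -- forward from heads along `se`. Merging traces share all later choices, so in-edges are unique
  -- in `L` and out-edges in `M`.
  let L : Set V := {x | ∃ e ∈ C,
    Relation.ReflTransGen (fun x y => x ≠ s ∧ y = G.src (pe x)) (G.src e) x}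
  let M : Set V := {x | ∃ e ∈ C,
    Relation.ReflTransGen (fun x y => x ≠ t ∧ y = G.tgt (se x)) (G.tgt e) x}
  have hL : ∀ x ∈ L, (∃ e ∈ H.edges, G.src e = x) ∧ ∃ e ∈ C, ∃ p, H.IsPath x p (G.src e) := by
    rintro x ⟨e, he, hx⟩
    induction hx with
    | refl => exact ⟨⟨e, hCH e he, rfl⟩, e, he, [], isPath_nil⟩
    | tail _ hy ih =>
      obtain ⟨hys, rfl⟩ := hy
      obtain ⟨⟨f, hf, hfy⟩, g, hg, p, hp⟩ := ih
      obtain ⟨h₁, h₂⟩ := hpe _ f hf hfy hys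
      exact ⟨⟨_, h₁, rfl⟩, g, hg, _ :: p, isPath_cons.2 ⟨rfl, h₁, h₂.symm ▸ hp⟩⟩
  have hM : ∀ x ∈ M, (∃ e ∈ H.edges, G.tgt e = x) ∧ ∃ e ∈ C, ∃ p, H.IsPath (G.tgt e) p x := by
    rintro x ⟨e, he, hx⟩
    induction hx with
    | refl => exact ⟨⟨e, hCH e he, rfl⟩, e, he, [], isPath_nil⟩
    | tail _ hy ih =>
      obtain ⟨hyt, rfl⟩ := hy
      obtain ⟨⟨f, hf, hfy⟩, g, hg, p, hp⟩ := ih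
      obtain ⟨h₁, h₂⟩ := hse _ f hf hfy hyt
      exact ⟨⟨_, h₁, rfl⟩, g, hg, p ++ [_], isPath_append.2
        ⟨_, hp, isPath_cons.2 ⟨h₂, h₁, isPath_nil⟩⟩⟩
  have hLpe : ∀ x ∈ L, x ≠ s → pe x ∈ H.edges ∧ G.tgt (pe x) = x ∧ G.src (pe x) ∈ L := by
    intro x hx hxs
    obtain ⟨⟨e, he, hex⟩, -⟩ := hL x hx
    obtain ⟨h₁, h₂⟩ := hpe x e he hex hxs
    obtain ⟨g, hg, hgx⟩ := hx
    exact ⟨h₁, h₂, g, hg, hgx.tail ⟨hxs, rfl⟩⟩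
  have hMse : ∀ x ∈ M, x ≠ t → se x ∈ H.edges ∧ G.src (se x) = x ∧ G.tgt (se x) ∈ M := by
    intro x hx hxt
    obtain ⟨⟨e, he, hex⟩, -⟩ := hM x hx
    obtain ⟨h₁, h₂⟩ := hse x e he hex hxt
    obtain ⟨g, hg, hgx⟩ := hx
    exact ⟨h₁, h₂, g, hg, hgx.tail ⟨hxt, rfl⟩⟩
  have hCL : ∀ e ∈ C, G.src e ∈ L := fun e he => ⟨e, he, .refl⟩
  have hCM : ∀ e ∈ C, G.tgt e ∈ M := fun e he => ⟨e, he, .refl⟩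
  -- A common vertex would make one edge of `C` reachable from another, or from itself.
  have hLM : ∀ x ∈ L, x ∉ M := by
    intro x hxL hxM
    obtain ⟨-, e, he, p, hp⟩ := hL x hxL
    obtain ⟨-, f, hf, q, hq⟩ := hM x hxM
    exact hC f hf e he ⟨q ++ p, isPath_append.2 ⟨x, hq, hp⟩⟩
  have hsL : s ∈ L := by
    have : ∀ n, ∀ x ∈ L, r x = n → s ∈ L := by
      intro n
      induction n using Nat.strong_induction_on with
      | _ n ih =>
      intro x hx hn
      by_cases hxs : x = s
      · exact hxs ▸ hx
      · obtain ⟨-, h₂, h₃⟩ := hLpe x hx hxs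
        have := hr (pe x)
        rw [h₂, hn] at this
        exact ih _ this _ h₃ rfl
    exact this _ _ (hCL e₀ he₀) rfl
  have htL : t ∉ L := fun h => by
    obtain ⟨⟨e, -, he⟩, -⟩ := hL t h
    exact hst.src_ne e he
  let W : Set E := {e | (∃ x ∈ L, x ≠ s ∧ e = pe x) ∨ e ∈ C ∨ ∃ x ∈ M, x ≠ t ∧ e = se x}
  have hWH : W ⊆ H.edges := by
    rintro e (⟨x, hx, hxs, rfl⟩ | he | ⟨x, hx, hxt, rfl⟩)
    · exact (hLpe x hx hxs).1
    · exact hCH e he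
    · exact (hMse x hx hxt).1
  have hWL : ∀ e ∈ W, G.tgt e ∈ L → e = pe (G.tgt e) ∧ G.src e ∈ L := by
    rintro e (⟨x, hx, hxs, rfl⟩ | he | ⟨x, hx, hxt, rfl⟩) h
    · obtain ⟨-, h₂, h₃⟩ := hLpe x hx hxs
      exact ⟨by rw [h₂], h₃⟩
    · exact absurd (hCM e he) (hLM _ h)
    · exact absurd (hMse x hx hxt).2.2 (hLM _ h)
  have hWM : ∀ e ∈ W, G.src e ∉ L → e = se (G.src e) := by
    rintro e (⟨x, hx, hxs, rfl⟩ | he | ⟨x, hx, hxt, rfl⟩) h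
    · exact absurd (hLpe x hx hxs).2.2 h
    · exact absurd (hCL e he) h
    · rw [(hMse x hx hxt).2.1]
  have hWsrc : ∀ e ∈ W, G.src e ∈ L ∨ G.src e ∈ M := by
    rintro e (⟨x, hx, hxs, rfl⟩ | he | ⟨x, hx, hxt, rfl⟩)
    · exact Or.inl (hLpe x hx hxs).2.2
    · exact Or.inl (hCL e he)
    · exact Or.inr ((hMse x hx hxt).2.1.symm ▸ hx)
  have hWtgt : ∀ e ∈ W, G.tgt e ∈ L ∨ G.tgt e ∈ M := by
    rintro e (⟨x, hx, hxs, rfl⟩ | he | ⟨x, hx, hxt, rfl⟩)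
    · exact Or.inl ((hLpe x hx hxs).2.1.symm ▸ hx)
    · exact Or.inr (hCM e he)
    · exact Or.inr (hMse x hx hxt).2.2
  have hLin : ∀ x ∈ L, x ≠ s → ∃ f ∈ W, G.tgt f = x := fun x hx hxs =>
    ⟨pe x, Or.inl ⟨x, hx, hxs, rfl⟩, (hLpe x hx hxs).2.1⟩
  have hMout : ∀ x ∈ M, x ≠ t → ∃ f ∈ W, G.src f = x := fun x hx hxt =>
    ⟨se x, Or.inr (Or.inr ⟨x, hx, hxt, rfl⟩), (hMse x hx hxt).2.1⟩
  have hMin : ∀ x ∈ M, ∃ f ∈ W, G.tgt f = x := by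
    rintro x ⟨e, he, hx⟩
    cases hx with
    | refl => exact ⟨e, Or.inr (Or.inl he), rfl⟩
    | tail hy hyx => exact ⟨_, Or.inr (Or.inr ⟨_, ⟨e, he, hy⟩, hyx.1, rfl⟩), hyx.2.symm⟩
  have hLout : ∀ x ∈ L, ∃ f ∈ W, G.src f = x := by
    rintro x ⟨e, he, hx⟩
    cases hx with
    | refl => exact ⟨e, Or.inr (Or.inl he), rfl⟩
    | tail hy hyx => exact ⟨_, Or.inl ⟨_, ⟨e, he, hy⟩, hyx.1, rfl⟩, hyx.2.symm⟩
  have htM : t ∈ M := by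
    obtain ⟨p, hp, -⟩ := isCovered_of_local (s := s) (t := t)
      (H := ⟨Set.univ, W, fun _ _ => trivial, fun _ _ => trivial⟩) hr
      (fun e he hes => (hWsrc e he).elim (fun h => hLin _ h hes) fun h => hMin _ h)
      (fun e he het => (hWtgt e he).elim (fun h => hLout _ h) fun h => hMout _ h het)
      e₀ (Or.inr (Or.inl he₀))
    rcases List.eq_nil_or_concat p with rfl | ⟨p, f, rfl⟩
    · exact absurd hsL ((show s = t from hp.1) ▸ htL)
    · rw [List.concat_eq_append] at hp
      obtain ⟨w, -, hf⟩ := isPath_append.1 hp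
      obtain ⟨-, hfW, hf⟩ := isPath_cons.1 hf
      obtain rfl : G.tgt f = t := hf.1
      exact (hWtgt f hfW).resolve_left htL
  let F : G.Subgraph := ⟨L ∪ M, W, hWsrc, hWtgt⟩
  have hD : F.IsClosedSet Lᶜ := fun e he hsrc htgt => hsrc (hWL e he htgt).2
  refine ⟨F, ⟨⟨fun v p hp => hr.eq_nil hp.1, Or.inl hsL, Or.inr htM, fun v hv => ⟨fun h => ?_, ?_⟩,
    fun v hv => ⟨fun h => ?_, ?_⟩⟩, fun p hp => ?_⟩, hWH, fun e he => Or.inr (Or.inl he)⟩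
  · by_contra hvs
    obtain ⟨f, hf, hfv⟩ := hv.elim (fun hv => hLin v hv hvs) fun hv => hMin v hv
    exact h f hf hfv
  · rintro rfl e -
    exact hst.tgt_ne e
  · by_contra hvt
    obtain ⟨f, hf, hfv⟩ := hv.elim (fun hv => hLout v hv) fun hv => hMout v hv hvt
    exact h f hf hfv
  · rintro rfl e -
    exact hst.src_ne e
  -- The private edge of a path is the one by which it leaves `L`.
  · obtain ⟨e, he, he₁, he₂⟩ := exists_crossing hp (not_not.2 hsL) (show t ∈ Lᶜ from htL)
    refine ⟨e, he, fun q hq heq => hD.path_unique hst ?_ ?_ hp hq he heq he₁ he₂⟩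
    · intro a ha b hb hab haD
      rw [(hWL a ha (not_not.1 haD)).1, hab, ← (hWL b hb (hab ▸ not_not.1 haD)).1]
    · intro a ha b hb hab haD
      rw [hWM a ha haD, hab, ← hWM b hb (hab ▸ haD)]

/-- A funnel without a central path forces the width of every larger subgraph to be large. -/
theorem IsFunnel.card_le_width [Finite E] (hr : G.IsRank r) (hst : G.IsTerminalPair s t)
    {F : G.Subgraph} (hF : F.IsFunnel s t) (hcentral : ∀ p, ¬ F.IsCentralPath p)
    {C : Finset E} (hCF : ∀ e ∈ C, e ∈ F.edges) (hC : ∀ e ∈ C, ∀ f ∈ C, ¬ F.Precedes e f)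
    (hH : H.IsCovered s t) (hFH : F.edges ⊆ H.edges) : C.card ≤ H.width s t := by
  classical
  have hcov := hF.1.isCovered hr
  have hne : s ≠ t := by
    rintro rfl
    obtain ⟨e, he, -⟩ := hF.2 [] isPath_nil
    simp at he
  -- Outside `D` nothing merges in `F`; inside `D` nothing forks, as this would give a central path.
  -- Adding `t` makes every path enter `D` even if `F` has no merging vertex.
  let D : Set V := {y | y = t ∨ ∃ u p, F.IsMerging u ∧ G.IsWalk u p y}
  have hDG : ∀ e, G.src e ∈ D → G.tgt e ∈ D := by
    rintro e (h | ⟨u, p, hu, hp⟩)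
    · exact absurd h (hst.src_ne e)
    · exact Or.inr ⟨u, p ++ [e], hu, isWalk_append.2 ⟨_, hp, isWalk_singleton e⟩⟩
  have hsD : s ∉ D := by
    rintro (h | ⟨u, p, hu, hp⟩)
    · exact hne h
    · obtain ⟨a, -, -, -, ha, -⟩ := hu.exists_ne
      exact hst.tgt_ne a (ha.trans (hst.eq_of_isWalk hp))
  have hin : ∀ e ∈ F.edges, ∀ f ∈ F.edges, G.tgt e = G.tgt f → G.tgt e ∉ D → e = f := by
    intro e he f hf hef hD
    by_contra hne
    exact hD (Or.inr ⟨_, [], (Set.one_lt_ncard_iff (Set.toFinite _)).2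
      ⟨e, f, ⟨he, rfl⟩, ⟨hf, hef.symm⟩, hne⟩, rfl⟩)
  have hout : ∀ e ∈ F.edges, ∀ f ∈ F.edges, G.src e = G.src f → G.src e ∈ D → e = f := by
    rintro e he f hf hef (h | ⟨u, p, hu, hp⟩)
    · exact absurd h (hst.src_ne e)
    · by_contra hne
      exact hcentral p ⟨u, _, hu, (Set.one_lt_ncard_iff (Set.toFinite _)).2
        ⟨e, f, ⟨he, rfl⟩, ⟨hf, hef.symm⟩, hne⟩, hp⟩
  have hDF : F.IsClosedSet D := fun e _ => hDG e
  have : ∀ e ∈ C, ∃ p f, F.IsPath s p t ∧ e ∈ p ∧ f ∈ p ∧ G.src f ∉ D ∧ G.tgt f ∈ D := by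
    intro e he
    obtain ⟨p, hp, hep⟩ := hcov e (hCF e he)
    obtain ⟨f, hf, h⟩ := exists_crossing hp hsD (Or.inl rfl)
    exact ⟨p, f, hp, hep, hf, h⟩
  choose! P x hP heP hxP hx₁ hx₂ using this
  -- Edges of `C` with the same crossing edge lie on the same path and would be comparable.
  have hinj : Set.InjOn x C := by
    intro e he f hf hef
    have hPP : P f = P e := hDF.path_unique hst hin hout (hP e he) (hP f hf) (hxP e he)
      (hef ▸ hxP f hf) (hx₁ e he) (hx₂ e he)
    rcases (hP e he).comparable (heP e he) (hPP ▸ heP f hf) with h | h | h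
    · exact h
    · exact absurd h (hC e he f hf)
    · exact absurd h (hC f hf e he)
  rw [← Finset.card_image_of_injOn hinj]
  refine hH.card_le_width (D := D) (fun e _ => hDG e) _ fun f hf => ?_
  obtain ⟨e, he, rfl⟩ := Finset.mem_image.1 hf
  exact ⟨hFH ((hP e he).2 _ (hxP e he)), hx₁ e he, hx₂ e he⟩

end Subgraph

/-- An antichain as large as the width of `G|_X` lies in a funnel of `G|_X`. It remains an antichain
there, and the funnel transfers its size to a lower bound for `G|_Y`. -/
theorem widthStable_of_not_isCentralPath [Fintype E] [DecidableEq V] {R : Type*} [CommRing R]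
    [LinearOrder R] [IsStrictOrderedRing R] (hr : G.IsRank r) (hst : G.IsTerminalPair s t)
    (h : ∀ (F : G.Subgraph) (p : List E), F.IsFunnel s t → ¬ F.IsCentralPath p) :
    G.WidthStable R s t := by
  intro X Y hX hY h0 hXY
  have hXcov := isCovered_restrict hr hst hX h0
  have hYcov := isCovered_restrict hr hst hY (h0.trans hXY)
  have hsub : (G.restrict X).edges ⊆ (G.restrict Y).edges := by
    intro e he
    exact ((lt_of_le_of_ne (h0 e) (Ne.symm he)).trans_le (hXY e)).ne'
  obtain ⟨C, hCX, hC, hcard⟩ := hXcov.exists_antichain hr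
  rcases C.eq_empty_or_nonempty with rfl | hne
  · exact hcard.trans (Nat.zero_le _)
  obtain ⟨F, hF, hFX, hCF⟩ := hXcov.exists_isFunnel hr hst hne hCX hC
  refine hcard.trans (hF.card_le_width hr hst (fun p => h F p hF) hCF ?_ hYcov (hFX.trans hsub))
  rintro e he f hf ⟨p, hp⟩
  exact hC e he f hf ⟨p, hp.1, fun g hg => hFX (hp.2 g hg)⟩

end MultiDigraph

theorem mainTheorem3 {V E : Type*} [Fintype V] [DecidableEq V] [Fintype E]
    {R : Type*} [CommRing R] [LinearOrder R] [IsStrictOrderedRing R]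
    (G : MultiDigraph V E) (s t : V) (hG : G.whole.IsSTDag s t) :
    List.TFAE [
      G.WidthStable R s t,
      G.HasPathsOfLargeWeight R s t,
      ¬ ∃ (F : G.Subgraph) (p : List E), F.IsFunnel s t ∧ F.IsCentralPath p] := by
  have hst := MultiDigraph.IsTerminalPair.of_isSTDag hG
  obtain ⟨r, hr⟩ := MultiDigraph.exists_isRank fun v p hp => hG.acyclic v p ⟨hp, fun _ _ => trivial⟩
  tfae_have 1 → 2 := fun h => h.hasPathsOfLargeWeight hr hst
  tfae_have 2 → 3 := fun h ⟨F, p, hF, hp⟩ => h.not_isCentralPath hr hst hF hp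
  tfae_have 3 → 1 := fun h => MultiDigraph.widthStable_of_not_isCentralPath hr hst
    fun F p hF hp => h ⟨F, p, hF, hp⟩
  tfae_finish
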